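/- Theorem (seven-fold piecewise isometry). Let $\zeta = e^{4\pi i/7}$ and let $L \subset \mathbb{C}$ be the lozenge with vertices $0,\ 1,\ 1-\zeta^{-1},\ -\zeta^{-1}$ (unit sides, angle $3\pi/7$ at $0$). The segment from $1$ to the point $1+\zeta$ of the opposite side cuts $L$ into the isosceles triangle $\Delta$ with vertices $1,\ 1+\zeta,\ 1-\zeta^{-1}$ and the isosceles trapezium $Z$ with vertices $0,\ 1,\ 1+\zeta,\ -\zeta^{-1}$. Let $T$ be the piecewise isometry of $L$ that rotates both pieces clockwise by $4\pi/7$, the triangle about $A = 2/(1-\zeta)$ and the trapezium about $B = 1/(1-\zeta)$; that is, $$T(z) = A + \zeta^{-1}(z-A) \quad (z \in \operatorname{int}\Delta), \qquad T(z) = B + \zeta^{-1}(z-B) \quad (z \in \operatorname{int} Z),$$ with any choice of values on the edges of the two pieces. Then Lebesgue-almost every point $z \in L$ has a periodic $T$-orbit, i.e. there is an integer $n \ge 1$ with $T^n(z) = z$. -/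

import Mathlib

open MeasureTheory

namespace SevenFold

noncomputable section

/-- The seventh root of unity `exp (4πi/7)`; multiplication by `ζ⁻¹` is the clockwise rotation
by `4π/7` about the origin. -/
def ζ : ℂ := Complex.exp (((4 * Real.pi / 7 : ℝ) : ℂ) * Complex.I)

/-- The lozenge `[0,1] + (-ζ⁻¹)[0,1]`: unit sides, interior angle `3π/7` at the vertex `0` and
`4π/7` at the vertex `1`. -/
def lozenge : Set ℂ := convexHull ℝ {0, 1, 1 - ζ⁻¹, -ζ⁻¹}

/-- The triangle cut off from the lozenge by the segment from the obtuse vertex `1` to the point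
`1 + ζ` of the opposite side: an isosceles triangle with legs of length `1` and apex `1`. -/
def triangle : Set ℂ := convexHull ℝ {1, 1 + ζ, 1 - ζ⁻¹}

/-- The rest of the lozenge, an isosceles trapezium. -/
def trapezium : Set ℂ := convexHull ℝ {0, 1, 1 + ζ, -ζ⁻¹}

/-- The clockwise rotation by `4π/7` about the point `c`. -/
def rotation (c z : ℂ) : ℂ := c + ζ⁻¹ * (z - c)

/-- The centre of the rotation of the triangle. -/
def centreA : ℂ := 2 / (1 - ζ)

/-- The centre of the rotation of the trapezium. -/
def centreB : ℂ := 1 / (1 - ζ)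

open Classical in
/-- The piecewise isometry of the lozenge: the open triangle is rotated about `centreA` and the
open trapezium is rotated about `centreB`. The edges of the pieces, a null set, may be sent
anywhere: `e` is the convention used there. -/
def lozengeMap (e : ℂ → ℂ) (z : ℂ) : ℂ :=
  if z ∈ interior triangle then rotation centreA z
  else if z ∈ interior trapezium then rotation centreB z
  else e z

end

end SevenFold

/-! The map is renormalisable. A scheme is a finite list of polygons, each moved by an isometry.
Each of the four schemes contains periodic polygons (cells) and scaled copies of schemes (links), on
which suitable iterates of the map act as the copied scheme does. The successive positions of a
cell, or of a piece of a copy, before its return are its floors, and up to finitely many lines the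
floors cover all pieces. Points on floors over a cell are periodic. A point on a floor over a copy
is a forward image of a point of the copy, hence periodic if that point is.

So, up to a null set, the nonperiodic part of a piece A lies in similar images of nonperiodic parts
of pieces B. Let M(A, B) be the sum of the squared scales of the floors in A with base B. The
weights form a positive integer vector w with M w ≤ (9/10) w. A bound K w for the areas of the
nonperiodic parts, uniform over all placements of the schemes, therefore improves to (9/10) K w
(`Bounded.mul`). Some K exists because the polygons are bounded (`exists_bounded`), and iteration
gives area zero (`volume_bad_eq_zero`).

All edges have one of fourteen directions and levels in ℤ[τ]. Inclusions and coverings thus become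
inequalities in ℤ[τ], settled by integer arithmetic in `checkScheme_schemes`. Their geometric
meaning is supplied by `walk_spec` and `exists_floor_of_covered`; `realised_lozengeScheme` and
`mem_region_of_mem_lozenge` tie the first scheme to the lozenge. -/

namespace SevenFold

/-! ### The ring `ℤ[τ]`, `τ = 2 cos (π / 7)` -/

/-- `2 cos (π / 7)`. -/
noncomputable def tau : ℝ := 2 * Real.cos (Real.pi / 7)

/-- `sin (n π / 7) / sin (π / 7)`. -/
noncomputable def sine (n : ℕ) : ℝ := Real.sin (n * (Real.pi / 7)) / Real.sin (Real.pi / 7)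

lemma sin_pi_div_seven_pos : 0 < Real.sin (Real.pi / 7) :=
  Real.sin_pos_of_pos_of_lt_pi (by positivity) (by linarith [Real.pi_pos])

/-- This separates τ from the other roots of its cubic, about 0.445 and -1.247. -/
lemma tau_gt : 1.7 < tau := by
  have h : Real.cos (Real.pi / 6) < Real.cos (Real.pi / 7) :=
    Real.cos_lt_cos_of_nonneg_of_le_pi (by positivity) (by linarith [Real.pi_pos])
      (by linarith [Real.pi_pos])
  rw [Real.cos_pi_div_six] at h
  have h3 : (1.7 : ℝ) < √3 := Real.lt_sqrt_of_sq_lt (by norm_num)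
  unfold tau
  linarith

/-- The angles 3π/7 and 4π/7 are supplementary. Comparing their cosines gives a quartic for τ with
the spurious root -2. -/
lemma tau_cubic : tau ^ 3 = tau ^ 2 + 2 * tau - 1 := by
  have h : Real.cos (3 * (Real.pi / 7)) = - Real.cos (4 * (Real.pi / 7)) := by
    rw [← Real.cos_pi_sub]; congr 1; ring
  have h4 : Real.cos (4 * (Real.pi / 7)) = 2 * (2 * Real.cos (Real.pi / 7) ^ 2 - 1) ^ 2 - 1 := by
    rw [← Real.cos_two_mul, ← Real.cos_two_mul]; congr 1; ring
  rw [h4, Real.cos_three_mul] at h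
  have ht := tau_gt
  have hc : Real.cos (Real.pi / 7) = tau / 2 := by unfold tau; ring
  rw [hc] at h
  have : (tau + 2) * (tau ^ 3 - (tau ^ 2 + 2 * tau - 1)) = 0 := by linear_combination 2 * h
  rcases mul_eq_zero.1 this with h | h
  · linarith
  · linarith

/-- Subtracting the values of the cubic at τ and s leaves τ - s times a quadratic that is positive
when both exceed 1.7. The sign of the cubic at s thus decides on which side of τ it lies. -/
lemma tau_mem : 1801937735804838 ≤ 10 ^ 15 * tau ∧ 10 ^ 15 * tau ≤ 1801937735804839 := by
  have h := tau_cubic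
  have ht := tau_gt
  have key : ∀ s : ℝ, 1.7 < s → 0 < tau ^ 2 + tau * s + s ^ 2 - tau - s - 2 := fun s hs => by
    nlinarith
  have eq : ∀ s : ℝ, (tau - s) * (tau ^ 2 + tau * s + s ^ 2 - tau - s - 2)
      = -(s ^ 3 - s ^ 2 - 2 * s + 1) := fun s => by linear_combination h
  constructor
  · by_contra! hlt
    have h1 := key (1801937735804838 / 10 ^ 15) (by norm_num)
    have h2 := eq (1801937735804838 / 10 ^ 15)
    have h3 : tau - 1801937735804838 / 10 ^ 15 < 0 := by linarith
    have h4 := mul_neg_of_neg_of_pos h3 h1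
    rw [h2] at h4
    norm_num at h4
  · by_contra! hlt
    have h1 := key (1801937735804839 / 10 ^ 15) (by norm_num)
    have h2 := eq (1801937735804839 / 10 ^ 15)
    have h3 : 0 < tau - 1801937735804839 / 10 ^ 15 := by linarith
    have h4 := mul_pos h3 h1
    rw [h2] at h4
    norm_num at h4

lemma tau_sq_mem : 3246979603717466 ≤ 10 ^ 15 * tau ^ 2 ∧
    10 ^ 15 * tau ^ 2 ≤ 3246979603717468 := by
  have h := tau_cubic
  have ht := tau_gt
  obtain ⟨h1, h2⟩ := tau_mem
  have e : tau ^ 2 * (tau - 1) = 2 * tau - 1 := by linear_combination h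
  constructor
  · nlinarith
  · nlinarith

/-- The number `a + b τ + d τ ^ 2`. -/
structure Zt where
  a : ℤ
  b : ℤ
  d : ℤ
deriving DecidableEq

namespace Zt

noncomputable def val (x : Zt) : ℝ := x.a + x.b * tau + x.d * tau ^ 2

def add (x y : Zt) : Zt := ⟨x.a + y.a, x.b + y.b, x.d + y.d⟩

def neg (x : Zt) : Zt := ⟨-x.a, -x.b, -x.d⟩

/-- Products are reduced by τ³ = τ² + 2τ - 1 and τ⁴ = 3τ² + τ - 1. -/
def mul (x y : Zt) : Zt :=
  ⟨x.a * y.a - (x.b * y.d + x.d * y.b) - x.d * y.d,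
   x.a * y.b + x.b * y.a + 2 * (x.b * y.d + x.d * y.b) + x.d * y.d,
   x.a * y.d + x.b * y.b + x.d * y.a + (x.b * y.d + x.d * y.b) + 3 * (x.d * y.d)⟩

def ofNat (n : ℕ) : Zt := ⟨n, 0, 0⟩

/-- A test that implies `0 ≤ x`. -/
def nonneg (x : Zt) : Bool :=
  decide ((x.b.natAbs : ℤ) + 2 * x.d.natAbs ≤
    10 ^ 15 * x.a + 1801937735804838 * x.b + 3246979603717466 * x.d)

/-- A test that implies `0 < x`. -/
def pos (x : Zt) : Bool :=
  decide ((x.b.natAbs : ℤ) + 2 * x.d.natAbs <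
    10 ^ 15 * x.a + 1801937735804838 * x.b + 3246979603717466 * x.d)

def le (x y : Zt) : Bool := (y.add x.neg).nonneg

@[simp] lemma val_add (x y : Zt) : (x.add y).val = x.val + y.val := by
  simp only [val, add]; push_cast; ring

@[simp] lemma val_neg (x : Zt) : x.neg.val = -x.val := by
  simp only [val, neg]; push_cast; ring

@[simp] lemma val_mul (x y : Zt) : (x.mul y).val = x.val * y.val := by
  have h4 : tau ^ 4 = 3 * tau ^ 2 + tau - 1 := by linear_combination (tau + 1) * tau_cubic
  simp only [val, mul]; push_cast
  linear_combination (-(x.b * y.d + x.d * y.b) : ℝ) * tau_cubic - (x.d * y.d : ℝ) * h4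

@[simp] lemma val_ofNat (n : ℕ) : (ofNat n).val = n := by simp [val, ofNat]

/-- The windows for 10¹⁵τ and 10¹⁵τ² have lengths 1 and 2, so the rounding error is at most |b| +
2|d|. -/
lemma approx (x : Zt) : ((10 ^ 15 * x.a + 1801937735804838 * x.b + 3246979603717466 * x.d : ℤ) : ℝ)
    - ((x.b.natAbs : ℤ) + 2 * x.d.natAbs : ℤ) ≤ 10 ^ 15 * x.val := by
  obtain ⟨h1, h2⟩ := tau_mem
  obtain ⟨h3, h4⟩ := tau_sq_mem
  push_cast
  have hb : -|(x.b : ℝ)| ≤ x.b * (10 ^ 15 * tau - 1801937735804838) := by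
    refine (neg_le_neg ?_).trans (neg_abs_le _)
    rw [abs_mul]
    exact mul_le_of_le_one_right (abs_nonneg _) (abs_le.2 ⟨by linarith, by linarith⟩)
  have hd : -(|(x.d : ℝ)| * 2) ≤ x.d * (10 ^ 15 * tau ^ 2 - 3246979603717466) := by
    refine (neg_le_neg ?_).trans (neg_abs_le _)
    rw [abs_mul]
    exact mul_le_mul_of_nonneg_left (abs_le.2 ⟨by linarith, by linarith⟩) (abs_nonneg _)
  simp only [val]
  linarith

lemma val_nonneg {x : Zt} (h : x.nonneg = true) : 0 ≤ x.val := by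
  have h1 : (_ : ℝ) ≤ _ := Int.cast_le.2 (of_decide_eq_true h)
  have h2 := x.approx
  linarith

lemma val_pos {x : Zt} (h : x.pos = true) : 0 < x.val := by
  have h1 : (_ : ℝ) < _ := Int.cast_lt.2 (of_decide_eq_true h)
  have h2 := x.approx
  linarith

lemma val_le {x y : Zt} (h : x.le y = true) : x.val ≤ y.val := by
  have := val_nonneg h
  simp at this
  linarith

end Zt

/-! ### Linear functionals in the fourteen directions -/

/-- The normalised functional with the `m`-th of fourteen directions. -/
noncomputable def lin (m : ℕ) (z : ℂ) : ℝ :=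
  (Real.cos (m * (Real.pi / 7)) * z.im - Real.sin (m * (Real.pi / 7)) * z.re) /
    Real.sin (Real.pi / 7)

lemma lin_add_seven (m : ℕ) (z : ℂ) : lin (m + 7) z = -lin m z := by
  have : ((m + 7 : ℕ) : ℝ) * (Real.pi / 7) = m * (Real.pi / 7) + Real.pi := by push_cast; ring
  rw [lin, lin, this, Real.cos_add_pi, Real.sin_add_pi]
  ring

lemma lin_add_fourteen (m : ℕ) (z : ℂ) : lin (m + 14) z = lin m z := by
  rw [show m + 14 = m + 7 + 7 from rfl, lin_add_seven, lin_add_seven, neg_neg]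

lemma lin_mod (m : ℕ) (z : ℂ) : lin (m % 14) z = lin m z := by
  have h : ∀ q r : ℕ, lin (r + 14 * q) z = lin r z := by
    intro q r
    induction q with
    | zero => rfl
    | succ q ih => rw [Nat.mul_succ, ← add_assoc, lin_add_fourteen, ih]
  rw [← h (m / 14) (m % 14), Nat.mod_add_div]

lemma lin_congr {m n : ℕ} (h : m % 14 = n % 14) (z : ℂ) : lin m z = lin n z := by
  rw [← lin_mod m, h, lin_mod]

lemma lin_add (m : ℕ) (z w : ℂ) : lin m (z + w) = lin m z + lin m w := by
  simp only [lin, Complex.add_re, Complex.add_im]; ring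

lemma lin_real_mul (m : ℕ) (r : ℝ) (z : ℂ) : lin m (r * z) = r * lin m z := by
  simp only [lin, Complex.re_ofReal_mul, Complex.im_ofReal_mul]; ring

/-- Three functionals are linearly dependent. -/
lemma sine_mul_lin (i p q : ℕ) (z : ℂ) :
    sine (p + q) * lin (i + p) z = sine q * lin i z + sine p * lin (i + p + q) z := by
  simp only [sine, lin]
  push_cast
  set α := Real.pi / 7
  rw [show (i + p + q : ℝ) * α = i * α + p * α + q * α by ring,
    show (i + p : ℝ) * α = i * α + p * α by ring, show (p + q : ℝ) * α = p * α + q * α by ring]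
  simp only [Real.sin_add, Real.cos_add]
  have hp := Real.sin_sq_add_cos_sq (p * α)
  linear_combination (Real.sin (q * α) * (Real.cos (i * α) * z.im - Real.sin (i * α) * z.re) /
    Real.sin α ^ 2) * hp

lemma sine_succ_succ (n : ℕ) : sine (n + 2) = tau * sine (n + 1) - sine n := by
  simp only [sine, tau]
  push_cast
  set α := Real.pi / 7
  rw [show (n + 2 : ℝ) * α = (n + 1) * α + α by ring, show (n : ℝ) * α = (n + 1) * α - α by ring,
    Real.sin_add, Real.sin_sub]
  ring

lemma sine_zero : sine 0 = 0 := by simp [sine]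

lemma sine_one : sine 1 = 1 := by
  simp only [sine, Nat.cast_one, one_mul]
  exact div_self sin_pi_div_seven_pos.ne'

lemma sine_add_seven (n : ℕ) : sine (n + 7) = -sine n := by
  have : ((n + 7 : ℕ) : ℝ) * (Real.pi / 7) = n * (Real.pi / 7) + Real.pi := by push_cast; ring
  rw [sine, sine, this, Real.sin_add_pi]
  ring

lemma sine_mod (m : ℕ) : sine (m % 14) = sine m := by
  have h : ∀ q r : ℕ, sine (r + 14 * q) = sine r := by
    intro q r
    induction q with
    | zero => rfl
    | succ q ih =>
      rw [Nat.mul_succ, ← add_assoc, show r + 14 * q + 14 = r + 14 * q + 7 + 7 from rfl,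
        sine_add_seven, sine_add_seven, ih, neg_neg]
  rw [← h (m / 14) (m % 14), Nat.mod_add_div]

/-- The linear dependence with p = 1 and q = m + 6. The coefficients lie in ℤ[τ], so two coordinates
in ℤ[τ] put all fourteen values there. -/
lemma lin_eq (m : ℕ) (z : ℂ) : lin m z = sine m * lin 1 z + sine (m + 6) * lin 0 z := by
  have h := sine_mul_lin 0 1 (m + 6) z
  rw [show 0 + 1 + (m + 6) = m + 7 by ring, lin_add_seven,
    sine_add_seven, sine_one] at h
  simp only [zero_add] at h
  linarith

/-- `sine` as an element of `ℤ[τ]`. -/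
def sineZ (n : ℕ) : Zt :=
  match n % 14 with
  | 0 => ⟨0, 0, 0⟩ | 1 => ⟨1, 0, 0⟩ | 2 => ⟨0, 1, 0⟩ | 3 => ⟨-1, 0, 1⟩
  | 4 => ⟨-1, 0, 1⟩ | 5 => ⟨0, 1, 0⟩ | 6 => ⟨1, 0, 0⟩ | 7 => ⟨0, 0, 0⟩
  | 8 => ⟨-1, 0, 0⟩ | 9 => ⟨0, -1, 0⟩ | 10 => ⟨1, 0, -1⟩
  | 11 => ⟨1, 0, -1⟩ | 12 => ⟨0, -1, 0⟩ | _ => ⟨-1, 0, 0⟩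

lemma val_sineZ (n : ℕ) : (sineZ n).val = sine n := by
  have h0 := sine_zero
  have h1 := sine_one
  have h2 := sine_succ_succ 0
  have h3 := sine_succ_succ 1
  have h7 : sine 7 = 0 := by rw [sine_add_seven 0, h0, neg_zero]
  have h6 : sine 6 = 1 := by
    have := sine_succ_succ 6
    rw [sine_add_seven 1, h7, h1] at this; linarith
  have h5 : sine 5 = tau := by
    have := sine_succ_succ 5
    rw [h7, h6] at this; linarith
  have h4 : sine 4 = tau ^ 2 - 1 := by
    have := sine_succ_succ 4
    rw [h6, h5] at this; linarith
  have e8 := sine_add_seven 1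
  have e9 := sine_add_seven 2
  have e10 := sine_add_seven 3
  have e11 := sine_add_seven 4
  have e12 := sine_add_seven 5
  have e13 := sine_add_seven 6
  norm_num at h2 h3 e8 e9 e10 e11 e12 e13
  rw [h1, h0] at h2
  rw [h2, h1] at h3
  rw [← sine_mod n]
  have hn : n % 14 < 14 := Nat.mod_lt _ (by norm_num)
  unfold sineZ
  generalize n % 14 = r at hn ⊢
  interval_cases r <;> simp only [Zt.val] <;> push_cast <;> simp only [*] <;> ring

/-- The inverse of `sine n` for `0 < n < 7`. -/
def sineInv (n : ℕ) : Zt :=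
  match n with
  | 1 => ⟨1, 0, 0⟩ | 2 => ⟨2, 1, -1⟩ | 3 => ⟨-1, -1, 1⟩
  | 4 => ⟨-1, -1, 1⟩ | 5 => ⟨2, 1, -1⟩ | _ => ⟨1, 0, 0⟩

/-- The sines are units of ℤ[τ], so bounds obtained by eliminating a direction stay in the ring. -/
lemma sineInv_mul {n : ℕ} (h0 : 0 < n) (h7 : n < 7) : (sineInv n).val * sine n = 1 := by
  rw [← val_sineZ]
  have h := tau_cubic
  have h4 : tau ^ 4 = 3 * tau ^ 2 + tau - 1 := by linear_combination (tau + 1) * tau_cubic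
  interval_cases n <;> simp only [Zt.val, sineInv, sineZ] <;> push_cast <;> norm_num
  · linear_combination -h
  · linear_combination h4 - h
  · linear_combination h4 - h
  · linear_combination -h

lemma sine_pos {n : ℕ} (h0 : 0 < n) (h7 : n < 7) : 0 < sine n := by
  refine div_pos (Real.sin_pos_of_pos_of_lt_pi ?_ ?_) sin_pi_div_seven_pos
  · have : (0 : ℝ) < n := by exact_mod_cast h0
    positivity
  · have : (n : ℝ) < 7 := by exact_mod_cast h7
    have := Real.pi_pos
    nlinarith

/-! ### Similarities and polygons with coordinates in `ℤ[τ]` -/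

/-- The value of the `m`-th functional at the point with `lin 0 = u` and `lin 1 = v`. -/
def linZ (m : ℕ) (u v : Zt) : Zt := ((sineZ m).mul v).add ((sineZ (m + 6)).mul u)

/-- The similarity `z ↦ l exp (-k π i / 7) z + t`, or `z ↦ l exp (-k π i / 7) (conj z) + t` if
`refl` is set; the translation `t` has `lin 0 t = u` and `lin 1 t = v`. -/
structure Sim where
  refl : Bool
  rot : ℕ
  scale : Zt
  u : Zt
  v : Zt
deriving DecidableEq

namespace Sim

/-- The direction that `φ` turns into the direction `m`. -/
def dir (φ : Sim) (m : ℕ) : ℕ :=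
  -- Multiplication by 13 is negation modulo 14. Conjugation exchanges the directions m and 7 - m.
  bif φ.refl then (7 + 13 * (m + φ.rot)) % 14 else (m + φ.rot) % 14

/-- The direction into which `φ` turns the direction `m`. -/
def dirInv (φ : Sim) (m : ℕ) : ℕ :=
  bif φ.refl then (7 + 13 * (m + φ.rot)) % 14 else (m + 13 * φ.rot) % 14

/-- The support in direction `m` of the image under `φ` of a set with support `s`. -/
def bound (φ : Sim) (m : ℕ) (s : Zt) : Zt := (φ.scale.mul s).add (linZ m φ.u φ.v)

/-- Rotations are reduced modulo 14, so that the checkers can compare composites by equality of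
their data. -/
def comp (φ ψ : Sim) : Sim where
  refl := xor φ.refl ψ.refl
  rot := bif φ.refl then (φ.rot + 13 * ψ.rot) % 14 else (φ.rot + ψ.rot) % 14
  scale := φ.scale.mul ψ.scale
  u := φ.bound 0 (linZ (φ.dir 0) ψ.u ψ.v)
  v := φ.bound 1 (linZ (φ.dir 1) ψ.u ψ.v)

def one : Sim := ⟨false, 0, ⟨1, 0, 0⟩, ⟨0, 0, 0⟩, ⟨0, 0, 0⟩⟩

def pow (φ : Sim) : ℕ → Sim
  | 0 => one
  | n + 1 => φ.comp (φ.pow n)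

end Sim

/-- A convex polygon: `(m, b)` stands for the half-plane `lin m z < b`. -/
abbrev Poly := List (ℕ × Zt)

def lookup (m : ℕ) : Poly → Option Zt
  | [] => none
  | e :: P => if e.1 = m then some e.2 else lookup m P

/-- A bound for `lin m` from those in the directions `m - p` and `m + q`. -/
def between (p q : ℕ) (a b : Zt) : Zt :=
  (sineInv (p + q)).mul (((sineZ q).mul a).add ((sineZ p).mul b))

/-- A bound for `lin m` on the polygon whose consecutive edges are listed in pairs. -/
def supportAt (m : ℕ) : List ((ℕ × Zt) × (ℕ × Zt)) → Option Zt
  | [] => none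
  | (e, f) :: L =>
    if e.1 = m then some e.2
    else
      let p := (m + 13 * e.1) % 14
      let q := (f.1 + 13 * m) % 14
      if 0 < p ∧ 0 < q ∧ p + q < 7 then some (between p q e.2 f.2) else supportAt m L

/-- The entries of a list without missing entries. -/
def collect {α : Type} : List (Option α) → Option (List α)
  | [] => some []
  | none :: _ => none
  | some x :: L => match collect L with
    | none => none
    | some y => some (x :: y)

/-- Consecutive edges are paired cyclically. Success means a bound in every direction, hence also
that the polygon is bounded. -/
def support (P : Poly) : Option (List Zt) :=
  collect ((List.range 14).map fun m => supportAt m (P.zip (P.rotate 1)))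

/-- Whether a set with supports `s` is mapped into `P` by `φ`. -/
def fits (s : List Zt) (φ : Sim) (P : Poly) : Bool :=
  P.all fun e => match s[φ.dir e.1]? with
    | none => false
    | some b => (φ.bound e.1 b).le e.2

/-- The image of a polygon. -/
def push (φ : Sim) (P : Poly) : Poly :=
  P.map fun e => (φ.dirInv e.1, φ.bound (φ.dirInv e.1) e.2)

/-! ### Renormalisation schemes -/

/-- One piece of a piecewise isometry. The numbers `weight` bound the relative sizes of the sets of
nonperiodic points. -/
structure Piece where
  edges : Poly
  move : Sim
  weight : ℕ

/-- A copy of a piecewise isometry that is induced by another one: `words` lists the itineraries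
of the pieces of the copy. -/
structure Link where
  child : ℕ
  sim : Sim
  words : List (List ℕ)

/-- A polygon all of whose points are periodic, with its itinerary. -/
structure Cell where
  edges : Poly
  word : List ℕ

/-- A certificate that a polygon is covered by given polygons. -/
inductive Cover where
  -- The three ways to finish or proceed: the newest half-plane misses the rest of the polygon; the
  -- polygon lies in floor `f`; or it is split along the edge of floor `f` in direction `m`.
  | empty (p q : ℕ)
  | inside (f : ℕ)
  | cut (f m : ℕ) (out inn : Cover)

/-- The list of coverings is parallel to the list of pieces. -/
structure Scheme where
  pieces : List Piece
  links : List Link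
  cells : List Cell
  covers : List Cover

/-- A member of the covering of a piece: the image of `base` under `sim`. -/
structure Floor where
  tag : ℕ
  base : Poly
  sim : Sim
  weight : ℕ

/-- Follow a set with supports `s`, placed by `φ`, along an itinerary. -/
def walk (As : List Piece) (s : List Zt) : Sim → List ℕ → Option (List (ℕ × Sim) × Sim)
  | φ, [] => some ([], φ)
  | φ, i :: w =>
    match As[i]? with
    | none => none
    | some A =>
      if fits s φ A.edges then
        match walk As s (A.move.comp φ) w with
        | none => none
        | some (F, ψ) => some ((i, φ) :: F, ψ)
      else none

/-- The return map sends the cell into itself and its seventh power is the identity, so every point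
is periodic. Floors over a cell carry no nonperiodic points and get weight 0. -/
def cellFloors (As : List Piece) (c : Cell) : Option (List Floor) :=
  match support c.edges with
  | none => none
  | some s =>
    match walk As s Sim.one c.word with
    | none => none
    | some (F, ψ) =>
      if c.word ≠ [] ∧ ψ.scale.pos ∧ fits s ψ c.edges ∧ ψ.pow 7 = Sim.one ∧
          F.all (fun x => x.2.scale.pos) then
        some (F.map fun x => ⟨x.1, c.edges, x.2, 0⟩)
      else none

/-- The itinerary must end where the copied map would put the piece. It need not be a first return.
-/
def pieceFloors (As : List Piece) (φ : Sim) (B : Piece) (w : List ℕ) : Option (List Floor) :=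
  match support B.edges with
  | none => none
  | some s =>
    match walk As s φ w with
    | none => none
    | some (F, ψ) =>
      if w ≠ [] ∧ ψ = φ.comp B.move ∧ F.all (fun x => x.2.scale.pos) then
        some (F.map fun x => ⟨x.1, B.edges, x.2, B.weight⟩)
      else none

def gather {α : Type} (L : List (Option (List α))) : Option (List α) :=
  (collect L).map List.flatten

def linkFloors (sys : List Scheme) (As : List Piece) (k : Link) : Option (List Floor) :=
  match sys[k.child]? with
  | none => none
  | some S =>
    if k.words.length = S.pieces.length then
      gather (List.zipWith (pieceFloors As k.sim) S.pieces k.words)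
    else none

/-- Floor numbers in the covering certificates refer to this order: links before cells. -/
def floors (sys : List Scheme) (S : Scheme) : Option (List Floor) :=
  gather (S.links.map (linkFloors sys S.pieces) ++ S.cells.map (cellFloors S.pieces))

/-- Whether `lin m < b` cannot hold on `R`. -/
def excluded (p q : ℕ) (m : ℕ) (b : Zt) (R : Poly) : Bool :=
  if p = 0 then
    match lookup ((m + 7) % 14) R with
    | none => false
    | some c => c.le b.neg
  else
    match lookup ((m + 7 + 13 * p) % 14) R, lookup ((m + 7 + q) % 14) R with
    | some c, some d => 0 < q && p + q < 7 && (between p q c d).le b.neg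
    | _, _ => false

/-- Whether `c` certifies that `R` is covered by the floors with the given tag. -/
def covered (F : List Floor) (tag : ℕ) : Cover → Poly → Bool
  | .empty p q, R =>
    match R with
    | [] => false
    | e :: R' => excluded p q e.1 e.2 R'
  | .inside f, R =>
    match F[f]? with
    | none => false
    | some x => x.tag == tag && (push x.sim x.base).all fun e =>
        match lookup e.1 R with
        | none => false
        | some b => b.le e.2
  | .cut f m out inn, R =>
    match F[f]? with
    | none => false
    | some x =>
      match lookup m (push x.sim x.base) with
      | none => false
      -- Both halves are open. The dropped line contains no generic point.
      | some b => covered F tag out (((m + 7) % 14, b.neg) :: R) && covered F tag inn ((m, b) :: R)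

/-- The weighted number of floors with a given tag. -/
def load (tag : ℕ) : List Floor → Zt
  | [] => ⟨0, 0, 0⟩
  | x :: F =>
    if x.tag = tag then ((x.sim.scale.mul x.sim.scale).mul (Zt.ofNat x.weight)).add (load tag F)
    else load tag F

/-- The numbers 10 and 9 encode the contraction factor 9/10 in integers. -/
def checkPiece (F : List Floor) (k : ℕ) (A : Piece) (c : Cover) : Bool :=
  (support A.edges).isSome && 0 < A.weight &&
    ((Zt.ofNat 10).mul (load k F)).le (Zt.ofNat (9 * A.weight)) && covered F k c A.edges

def checkScheme (sys : List Scheme) (S : Scheme) : Bool :=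
  match floors sys S with
  | none => false
  | some F => (List.range S.pieces.length).all fun k =>
      match S.pieces[k]?, S.covers[k]? with
      | some A, some c => checkPiece F k A c
      | _, _ => false

/-! ### The renormalisation of the lozenge map -/

/-- The map of the lozenge. It induces a piecewise isometry of the triangle similar to the given
one. -/
def lozengeScheme : Scheme where
  -- Piece 0 is the trapezium and piece 1 the triangle.
  pieces := [
    ⟨[(0, ⟨-1, 0, 1⟩), (3, ⟨0, 0, 0⟩), (7, ⟨0, 0, 0⟩), (11, ⟨-1, 0, 1⟩)], ⟨false, 4, ⟨1, 0, 0⟩,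
    ⟨-1, 0, 1⟩, ⟨0, 1, 0⟩⟩, 243⟩,
    ⟨[(0, ⟨-1, 0, 1⟩), (4, ⟨1, 0, -1⟩), (10, ⟨-1, 0, 1⟩)], ⟨false, 4, ⟨1, 0, 0⟩, ⟨-2, 0, 2⟩, ⟨0,
    2, 0⟩⟩, 140⟩]
  links := [
    ⟨1, ⟨false, 0, ⟨2, 1, -1⟩, ⟨0, 0, 0⟩, ⟨-1, 0, 0⟩⟩, [[1, 0], [1, 0, 0, 0, 0], [1, 0, 0, 0, 0,
    1, 0, 0, 0, 0], [1, 0, 0, 0, 0, 1, 1, 1, 1, 0, 0, 0, 0]]⟩]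
  cells := [
    ⟨[(1, ⟨-2, 0, 1⟩), (3, ⟨0, 0, 0⟩), (5, ⟨-2, -1, 1⟩), (7, ⟨0, 0, 0⟩), (9, ⟨-2, 0, 1⟩), (11,
    ⟨-1, 0, 1⟩), (13, ⟨-1, 0, 1⟩)], [0]⟩,
    ⟨[(0, ⟨-1, 0, 1⟩), (2, ⟨3, 0, -1⟩), (4, ⟨1, 0, -1⟩), (6, ⟨1, 0, -1⟩), (8, ⟨3, 0, -1⟩), (10,
    ⟨-1, 0, 1⟩), (12, ⟨3, 2, -1⟩)], [1]⟩]
  covers := [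
    .cut 30 1 (.cut 1 6 (.cut 6 4 (.cut 21 12 (.inside 11) (.inside 21)) (.cut 6 12 (.cut 29 4
    (.inside 16) (.inside 29)) (.inside 6))) (.inside 1)) (.cut 30 13 (.cut 3 2 (.cut 18 10
    (.inside 8) (.inside 18)) (.cut 3 10 (.cut 26 2 (.inside 13) (.inside 26)) (.inside 3)))
    (.cut 30 5 (.cut 5 2 (.cut 28 8 (.inside 15) (.inside 28)) (.cut 5 8 (.cut 20 2 (.inside 10)
    (.inside 20)) (.inside 5))) (.cut 30 9 (.cut 4 6 (.cut 27 12 (.inside 14) (.inside 27)) (.cut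
    4 12 (.cut 19 6 (.inside 9) (.inside 19)) (.inside 4))) (.inside 30)))),
    .cut 31 6 (.cut 0 12 (.cut 2 0 (.cut 22 8 (.inside 12) (.inside 22)) (.cut 2 6 (.cut 17 0
    (.inside 7) (.inside 17)) (.inside 2))) (.inside 0)) (.cut 31 8 (.inside 25) (.cut 31 2
    (.inside 23) (.cut 31 12 (.inside 24) (.inside 31))))]

/-- A piecewise isometry of a triangle with angles `π / 7`, `3π / 7`, `3π / 7` that induces a
smaller copy of itself and a copy of `cornerScheme`. -/
def triangleScheme : Scheme where
  pieces := [
    ⟨[(4, ⟨0, 0, 0⟩), (10, ⟨0, 0, 0⟩), (12, ⟨1, 0, 0⟩)], ⟨false, 8, ⟨1, 0, 0⟩, ⟨-1, 0, 1⟩, ⟨0, 1,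
    0⟩⟩, 94⟩,
    ⟨[(0, ⟨-1, 0, 1⟩), (6, ⟨0, -1, 0⟩), (10, ⟨0, 0, 0⟩)], ⟨false, 6, ⟨1, 0, 0⟩, ⟨-1, 1, 1⟩, ⟨-1,
    1, 1⟩⟩, 23⟩,
    ⟨[(5, ⟨-1, 0, 0⟩), (7, ⟨0, -1, 0⟩), (13, ⟨0, 1, 0⟩)], ⟨false, 12, ⟨1, 0, 0⟩, ⟨-1, 1, 0⟩, ⟨0,
    0, 0⟩⟩, 16⟩,
    ⟨[(0, ⟨0, 1, 0⟩), (5, ⟨-1, 0, 0⟩), (10, ⟨0, 0, 0⟩)], ⟨false, 10, ⟨1, 0, 0⟩, ⟨0, 1, 0⟩, ⟨1, 0,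
    0⟩⟩, 47⟩]
  links := [
    ⟨1, ⟨false, 0, ⟨2, -1, 0⟩, ⟨0, 0, 0⟩, ⟨0, 0, 0⟩⟩, [[0, 1, 0], [0, 1, 1, 1, 0], [0, 1, 2, 0,
    0, 2, 1, 0], [0, 1, 2, 0, 0, 3, 0, 0, 2, 1, 0]]⟩,
    ⟨2, ⟨false, 0, ⟨2, -1, 0⟩, ⟨-4, -1, 2⟩, ⟨-4, -1, 2⟩⟩, [[0, 3, 3, 0, 0, 0], [0, 3, 3, 0, 0, 0,
    0, 3, 3, 0, 0, 3, 0], [0, 3, 3, 0, 0, 0, 0, 3, 3, 0, 0, 3, 0, 0, 3, 0]]⟩]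
  cells := [
    ⟨[(0, ⟨0, -1, 1⟩), (2, ⟨1, 0, 0⟩), (4, ⟨0, 0, 0⟩), (6, ⟨1, -1, 0⟩), (8, ⟨1, -1, 0⟩), (10, ⟨0,
    0, 0⟩), (12, ⟨1, 0, 0⟩)], [0]⟩,
    ⟨[(0, ⟨-1, 0, 1⟩), (2, ⟨0, -1, 1⟩), (4, ⟨0, -2, 1⟩), (6, ⟨0, -1, 0⟩), (8, ⟨0, -1, 0⟩), (10,
    ⟨0, -2, 1⟩), (12, ⟨0, -1, 1⟩)], [1]⟩,
    ⟨[(1, ⟨0, 1, 0⟩), (5, ⟨-1, 0, 0⟩), (7, ⟨0, -1, 0⟩), (11, ⟨0, 2, -1⟩)], [2, 2, 1, 2]⟩,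
    ⟨[(0, ⟨0, 1, 0⟩), (2, ⟨1, 2, -1⟩), (4, ⟨0, 0, 0⟩), (6, ⟨2, 0, -1⟩), (8, ⟨0, 1, -1⟩), (10, ⟨1,
    1, -1⟩), (12, ⟨1, 0, 0⟩)], [0, 0, 3]⟩,
    ⟨[(0, ⟨-1, 0, 1⟩), (3, ⟨-1, 1, 0⟩), (6, ⟨0, -1, 0⟩), (9, ⟨0, 1, -1⟩), (11, ⟨0, 2, -1⟩)], [1,
    1, 2, 2, 1]⟩,
    ⟨[(0, ⟨-1, 0, 1⟩), (4, ⟨0, -2, 1⟩), (9, ⟨0, 1, -1⟩)], [1, 1, 1, 1, 2, 1]⟩]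
  covers := [
    .cut 62 0 (.cut 68 0 (.cut 2 10 (.cut 7 2 (.cut 26 8 (.inside 15) (.inside 26)) (.cut 7 8
    (.cut 19 2 (.inside 11) (.inside 19)) (.inside 7))) (.inside 2)) (.cut 68 2 (.inside 22)
    (.cut 68 8 (.cut 32 2 (.cut 58 6 (.inside 42) (.cut 58 10 (.inside 45) (.inside 58))) (.cut
    32 8 (.cut 51 2 (.inside 38) (.inside 51)) (.inside 32))) (.cut 68 10 (.inside 61) (.cut 68 6
    (.inside 55) (.inside 68)))))) (.cut 62 2 (.cut 30 10 (.cut 49 4 (.inside 36) (.inside 49))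
    (.inside 30)) (.cut 62 6 (.cut 69 6 (.cut 0 12 (.cut 3 0 (.cut 20 8 (.inside 12) (.inside
    20)) (.cut 3 6 (.cut 16 0 (.inside 8) (.inside 16)) (.inside 3))) (.inside 0)) (.cut 69 8
    (.inside 23) (.cut 69 0 (.cut 27 10 (.cut 59 2 (.cut 46 0 (.cut 39 1 (.empty 2 2) (.inside
    39)) (.cut 46 4 (.inside 33) (.inside 46))) (.cut 59 12 (.inside 43) (.inside 59))) (.cut 27
    0 (.cut 52 8 (.inside 39) (.inside 52)) (.inside 27))) (.cut 69 2 (.cut 33 3 (.inside 27)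
    (.cut 33 11 (.inside 46) (.inside 33))) (.cut 69 12 (.inside 56) (.inside 69)))))) (.cut 62 8
    (.cut 31 2 (.cut 50 10 (.inside 37) (.inside 50)) (.inside 31)) (.inside 62)))),
    .cut 63 10 (.cut 1 2 (.cut 72 8 (.cut 75 12 (.cut 66 11 (.cut 25 0 (.inside 14) (.inside 25))
    (.inside 66)) (.inside 75)) (.cut 72 5 (.inside 77) (.cut 72 11 (.inside 6) (.inside 72))))
    (.cut 1 4 (.cut 4 12 (.cut 17 6 (.inside 9) (.inside 17)) (.inside 4)) (.inside 1))) (.cut 63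
    8 (.inside 81) (.cut 63 12 (.inside 79) (.cut 63 2 (.cut 71 3 (.inside 5) (.cut 71 11
    (.inside 76) (.inside 71))) (.cut 63 4 (.inside 78) (.inside 63))))),
    .cut 73 8 (.cut 74 10 (.cut 65 9 (.cut 24 12 (.inside 13) (.inside 24)) (.inside 65)) (.cut
    74 4 (.inside 64) (.inside 74))) (.cut 73 11 (.inside 80) (.cut 73 2 (.cut 67 3 (.cut 18 0
    (.inside 10) (.inside 18)) (.inside 67)) (.inside 73))),
    .cut 70 4 (.cut 29 6 (.cut 48 10 (.cut 57 6 (.inside 44) (.cut 57 2 (.inside 41) (.inside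
    57))) (.cut 48 0 (.inside 35) (.inside 48))) (.cut 29 10 (.cut 41 9 (.empty 3 2) (.inside
    41)) (.inside 29))) (.cut 70 6 (.cut 28 2 (.cut 60 8 (.cut 47 6 (.cut 40 7 (.empty 2 2)
    (.inside 40)) (.cut 47 10 (.inside 34) (.inside 47))) (.inside 60)) (.cut 28 6 (.cut 53 0
    (.inside 40) (.inside 53)) (.inside 28))) (.cut 70 2 (.inside 54) (.cut 70 8 (.cut 34 9
    (.inside 28) (.cut 34 3 (.inside 47) (.inside 34))) (.cut 70 12 (.inside 21) (.inside 70)))))]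

/-- A piecewise isometry of a triangle with angles `2π / 7`, `2π / 7`, `3π / 7` that induces a copy
of `innerScheme` at one of the corners. -/
def cornerScheme : Scheme where
  pieces := [
    ⟨[(0, ⟨1, 0, 0⟩), (4, ⟨0, 0, 0⟩), (10, ⟨0, 0, 0⟩)], ⟨false, 10, ⟨1, 0, 0⟩, ⟨1, 0, 0⟩, ⟨2, 1,
    -1⟩⟩, 56⟩,
    ⟨[(3, ⟨0, 0, 0⟩), (9, ⟨0, 0, 0⟩), (11, ⟨-1, -1, 1⟩)], ⟨false, 2, ⟨1, 0, 0⟩, ⟨2, 1, -1⟩, ⟨2,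
    1, -1⟩⟩, 61⟩,
    ⟨[(0, ⟨1, 0, 0⟩), (4, ⟨1, 1, -1⟩), (9, ⟨0, 0, 0⟩)], ⟨false, 0, ⟨1, 0, 0⟩, ⟨1, 1, -1⟩, ⟨3, 0,
    -1⟩⟩, 63⟩]
  links := [
    ⟨3, ⟨false, 0, ⟨2, 1, -1⟩, ⟨0, 0, 0⟩, ⟨0, 0, 0⟩⟩, [[2], [0, 2], [1, 2], [1, 1, 2], [1, 0, 1,
    2], [1, 0, 0, 0, 0, 1, 2]]⟩]
  cells := [
    ⟨[(0, ⟨1, 0, 0⟩), (2, ⟨-4, -1, 2⟩), (4, ⟨0, 0, 0⟩), (6, ⟨-2, -1, 1⟩), (8, ⟨-2, -1, 1⟩), (10,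
    ⟨0, 0, 0⟩), (12, ⟨-4, -1, 2⟩)], [0]⟩]
  covers := [
    .cut 19 6 (.cut 1 0 (.cut 16 8 (.inside 9) (.inside 16)) (.inside 1)) (.cut 19 8 (.inside 13)
    (.cut 19 2 (.inside 15) (.cut 19 12 (.inside 14) (.inside 19)))),
    .cut 3 0 (.cut 6 1 (.cut 17 12 (.inside 10) (.inside 17)) (.inside 6)) (.cut 3 6 (.cut 5 5
    (.cut 12 8 (.inside 8) (.inside 12)) (.inside 5)) (.inside 3)),
    .cut 2 8 (.cut 4 12 (.cut 7 13 (.cut 18 10 (.inside 11) (.inside 18)) (.inside 7)) (.cut 4 7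
    (.inside 0) (.inside 4))) (.inside 2)]

/-- A piecewise isometry that induces a smaller copy of itself and two smaller copies of
`cornerScheme`, one of which is reflected. -/
def innerScheme : Scheme where
  pieces := [
    ⟨[(0, ⟨1, 0, 0⟩), (4, ⟨1, -1, 0⟩), (9, ⟨0, 0, 0⟩)], ⟨false, 0, ⟨1, 0, 0⟩, ⟨1, -1, 0⟩, ⟨1, 1,
    -1⟩⟩, 17⟩,
    ⟨[(0, ⟨1, 0, 0⟩), (4, ⟨0, 0, 0⟩), (10, ⟨0, 0, 0⟩)], ⟨false, 10, ⟨1, 0, 0⟩, ⟨1, 0, 0⟩, ⟨2, 1,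
    -1⟩⟩, 44⟩,
    ⟨[(0, ⟨1, 0, 0⟩), (3, ⟨0, 0, 0⟩), (6, ⟨1, -1, 0⟩), (9, ⟨0, 0, 0⟩), (11, ⟨-1, 1, 0⟩)], ⟨false,
    2, ⟨1, 0, 0⟩, ⟨2, -1, 0⟩, ⟨2, 1, -1⟩⟩, 40⟩,
    ⟨[(3, ⟨0, 0, 0⟩), (5, ⟨1, 1, -1⟩), (9, ⟨0, 0, 0⟩), (13, ⟨-1, 1, 0⟩)], ⟨false, 4, ⟨1, 0, 0⟩,
    ⟨1, 0, 0⟩, ⟨1, 0, 0⟩⟩, 18⟩,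
    ⟨[(1, ⟨2, -1, 0⟩), (3, ⟨0, 0, 0⟩), (9, ⟨0, 0, 0⟩)], ⟨false, 0, ⟨1, 0, 0⟩, ⟨1, -2, 1⟩, ⟨0, 2,
    -1⟩⟩, 20⟩,
    ⟨[(3, ⟨0, 0, 0⟩), (8, ⟨-2, 1, 0⟩), (12, ⟨-1, -1, 1⟩)], ⟨false, 2, ⟨1, 0, 0⟩, ⟨1, -2, 1⟩, ⟨2,
    1, -1⟩⟩, 18⟩]
  links := [
    ⟨3, ⟨false, 0, ⟨2, -1, 0⟩, ⟨0, 0, 0⟩, ⟨0, 0, 0⟩⟩, [[4, 0], [1, 0], [4, 2, 4, 0], [4, 2, 4, 2,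
    4, 0], [4, 2, 1, 2, 4, 0], [4, 2, 1, 2, 5, 2, 1, 2, 4, 0]]⟩,
    ⟨2, ⟨false, 9, ⟨3, 2, -2⟩, ⟨1, 0, 0⟩, ⟨-1, 1, 0⟩⟩, [[1, 1, 1, 3, 3, 3, 1], [1, 1, 1, 2, 1, 2,
    1, 2, 1, 2, 1, 2, 1, 1, 1, 1, 3, 3, 3, 1], [1, 1, 1, 2, 1, 2, 1, 2, 1, 2, 1, 2, 1, 2, 1, 1,
    1, 1, 3, 3, 3, 1]]⟩,
    ⟨2, ⟨true, 13, ⟨-1, -3, 2⟩, ⟨-1, -1, 1⟩, ⟨-1, -1, 1⟩⟩, [[1, 2, 1, 2, 5, 2, 5, 2], [1, 2, 1,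
    2, 5, 2, 5, 2, 1, 2, 5, 2, 1, 2, 5, 2, 5, 2], [1, 2, 1, 2, 5, 2, 5, 2, 1, 2, 5, 2, 1, 2, 5,
    2, 1, 2, 5, 2, 5, 2]]⟩]
  cells := [
    ⟨[(1, ⟨2, 1, -1⟩), (3, ⟨0, 0, 0⟩), (5, ⟨1, 1, -1⟩), (7, ⟨1, 1, -1⟩), (9, ⟨0, 0, 0⟩), (11, ⟨2,
    1, -1⟩), (13, ⟨-1, 1, 0⟩)], [3]⟩,
    ⟨[(0, ⟨1, 0, 0⟩), (2, ⟨-4, -1, 2⟩), (4, ⟨0, 0, 0⟩), (6, ⟨-2, -1, 1⟩), (8, ⟨-2, -1, 1⟩), (10,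
    ⟨0, 0, 0⟩), (12, ⟨-4, -1, 2⟩)], [1]⟩,
    ⟨[(1, ⟨2, 1, -1⟩), (3, ⟨2, -1, 0⟩), (5, ⟨3, 0, -1⟩), (7, ⟨1, 1, -1⟩), (9, ⟨3, 0, -1⟩), (11,
    ⟨2, -1, 0⟩), (13, ⟨2, 1, -1⟩)], [1, 2]⟩,
    ⟨[(0, ⟨0, 2, -1⟩), (2, ⟨-3, 0, 1⟩), (4, ⟨0, 0, 0⟩), (6, ⟨-2, 1, 0⟩), (8, ⟨-2, 1, 0⟩), (10,
    ⟨0, 0, 0⟩), (12, ⟨-3, 0, 1⟩)], [1, 2, 5, 2]⟩]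
  covers := [
    .cut 3 8 (.cut 7 12 (.cut 13 13 (.cut 29 10 (.inside 19) (.inside 29)) (.inside 13)) (.cut 7
    7 (.inside 1) (.inside 7))) (.inside 3),
    .cut 128 6 (.cut 129 7 (.cut 131 0 (.cut 65 5 (.cut 79 12 (.cut 43 6 (.cut 105 8 (.cut 117 2
    (.inside 95) (.inside 117)) (.cut 105 4 (.inside 87) (.inside 105))) (.inside 43)) (.cut 79 8
    (.cut 95 9 (.empty 2 3) (.inside 95)) (.inside 79))) (.cut 65 9 (.cut 81 0 (.cut 45 8 (.cut
    107 6 (.inside 89) (.inside 107)) (.inside 45)) (.cut 81 6 (.inside 99) (.inside 81)))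
    (.inside 65))) (.cut 131 6 (.cut 2 0 (.cut 26 8 (.inside 16) (.inside 26)) (.inside 2)) (.cut
    131 8 (.inside 22) (.cut 131 2 (.inside 113) (.cut 131 12 (.inside 121) (.inside 131))))))
    (.cut 129 5 (.cut 63 3 (.inside 41) (.inside 63)) (.cut 129 9 (.cut 67 11 (.inside 47)
    (.inside 67)) (.cut 129 3 (.cut 32 3 (.cut 74 9 (.inside 52) (.inside 74)) (.cut 32 9 (.cut
    61 1 (.inside 39) (.inside 61)) (.inside 32))) (.cut 129 1 (.inside 59) (.cut 129 11 (.inside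
    69) (.inside 129))))))) (.cut 128 8 (.cut 36 9 (.cut 78 1 (.inside 56) (.cut 78 5 (.cut 49 4
    (.empty 2 2) (.inside 49)) (.inside 78))) (.cut 36 5 (.cut 71 11 (.inside 49) (.inside 71))
    (.inside 36))) (.cut 128 2 (.cut 31 5 (.cut 58 13 (.inside 38) (.inside 58)) (.cut 31 13
    (.cut 73 5 (.inside 51) (.inside 73)) (.inside 31))) (.cut 128 12 (.cut 30 1 (.cut 57 9
    (.inside 37) (.inside 57)) (.cut 30 9 (.cut 72 1 (.inside 50) (.inside 72)) (.inside 30)))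
    (.inside 128)))),
    .cut 130 9 (.cut 132 6 (.cut 134 2 (.cut 64 11 (.cut 80 2 (.cut 44 10 (.cut 106 8 (.inside
    88) (.cut 106 12 (.cut 96 11 (.empty 2 2) (.inside 96)) (.inside 106))) (.inside 44)) (.cut
    80 8 (.cut 116 0 (.inside 98) (.inside 116)) (.cut 80 12 (.cut 114 4 (.inside 96) (.inside
    114)) (.inside 80)))) (.cut 64 7 (.cut 86 2 (.cut 42 8 (.cut 126 10 (.inside 104) (.inside
    126)) (.inside 42)) (.cut 86 10 (.inside 94) (.inside 86))) (.inside 64))) (.cut 134 0 (.cut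
    5 3 (.cut 84 6 (.cut 120 12 (.inside 102) (.inside 120)) (.cut 84 0 (.cut 92 1 (.cut 114 4
    (.empty 2 2) (.inside 114)) (.inside 92)) (.inside 84))) (.cut 5 6 (.empty 3 1) (.cut 5 0
    (.empty 1 3) (.inside 5)))) (.cut 134 12 (.cut 9 13 (.cut 5 3 (.empty 3 3) (.inside 5)) (.cut
    9 3 (.inside 124) (.inside 9))) (.cut 134 4 (.inside 112) (.cut 134 10 (.cut 21 8 (.inside
    15) (.inside 21)) (.cut 134 8 (.inside 25) (.inside 134))))))) (.cut 132 8 (.cut 11 7 (.cut 5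
    3 (.empty 3 3) (.inside 5)) (.cut 11 3 (.inside 110) (.inside 11))) (.cut 132 4 (.inside 118)
    (.cut 132 10 (.cut 27 12 (.inside 17) (.inside 27)) (.cut 132 12 (.inside 23) (.inside
    132)))))) (.cut 130 11 (.cut 66 13 (.cut 82 4 (.cut 46 12 (.cut 108 10 (.inside 90) (.inside
    108)) (.inside 46)) (.cut 82 10 (.cut 122 4 (.inside 100) (.inside 122)) (.inside 82)))
    (.inside 66)) (.cut 130 7 (.cut 62 5 (.inside 40) (.inside 62)) (.cut 130 13 (.cut 68 1
    (.inside 48) (.inside 68)) (.cut 130 1 (.inside 70) (.cut 130 5 (.inside 60) (.inside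
    130)))))),
    .cut 127 1 (.cut 33 7 (.cut 75 13 (.inside 53) (.inside 75)) (.inside 33)) (.cut 127 7 (.cut
    35 13 (.cut 77 5 (.inside 55) (.inside 77)) (.inside 35)) (.cut 127 11 (.cut 34 3 (.cut 76 9
    (.inside 54) (.inside 76)) (.inside 34)) (.inside 127))),
    .cut 4 0 (.cut 6 12 (.cut 12 13 (.cut 28 10 (.inside 18) (.inside 28)) (.inside 12)) (.cut 6
    4 (.inside 10) (.inside 6))) (.cut 4 11 (.inside 0) (.cut 4 6 (.cut 8 5 (.cut 20 8 (.inside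
    14) (.inside 20)) (.inside 8)) (.inside 4))),
    .cut 133 2 (.cut 83 8 (.cut 119 0 (.inside 101) (.cut 119 4 (.inside 97) (.inside 119)))
    (.cut 83 2 (.cut 109 8 (.inside 91) (.inside 109)) (.inside 83))) (.cut 133 4 (.cut 85 4
    (.cut 125 12 (.inside 103) (.inside 125)) (.cut 85 12 (.cut 115 6 (.inside 93) (.inside 115))
    (.inside 85))) (.cut 133 0 (.inside 123) (.cut 133 6 (.inside 111) (.cut 133 10 (.inside 24)
    (.inside 133)))))]

/-- The four schemes, in the order to which the links refer. -/
def schemes : List Scheme := [lozengeScheme, triangleScheme, cornerScheme, innerScheme]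

/-- The finite computation of the proof: itineraries, returns, coverings and the weight inequality
for all four schemes. -/
lemma checkScheme_schemes : schemes.all (checkScheme schemes) = true := by decide +kernel

/-! ### Coordinates and similarities as maps of the plane -/

lemma sine_seven : sine 7 = 0 := by rw [sine_add_seven 0, sine_zero, neg_zero]

lemma sine_six : sine 6 = 1 := by
  have := sine_succ_succ 6
  rw [sine_add_seven 1, sine_seven, sine_one] at this
  linarith

lemma val_linZ (m : ℕ) (u v : Zt) :
    (linZ m u v).val = sine m * v.val + sine (m + 6) * u.val := by
  simp [linZ, val_sineZ]

lemma val_linZ_zero (u v : Zt) : (linZ 0 u v).val = u.val := by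
  simp [val_linZ, sine_zero, sine_six]

lemma val_linZ_one (u v : Zt) : (linZ 1 u v).val = v.val := by
  simp [val_linZ, sine_one, sine_seven]

lemma lin_zero (z : ℂ) : lin 0 z = z.im / Real.sin (Real.pi / 7) := by simp [lin]

lemma lin_one (z : ℂ) : lin 1 z = (Real.cos (Real.pi / 7) * z.im - Real.sin (Real.pi / 7) * z.re) /
    Real.sin (Real.pi / 7) := by simp [lin]

lemma ext_lin {z w : ℂ} (h0 : lin 0 z = lin 0 w) (h1 : lin 1 z = lin 1 w) : z = w := by
  have hs := sin_pi_div_seven_pos.ne'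
  rw [lin_zero, lin_zero, div_left_inj' hs] at h0
  rw [lin_one, lin_one, div_left_inj' hs, h0, sub_right_inj, mul_right_inj' hs] at h1
  exact Complex.ext h1 h0

/-- The point with given values of `lin 0` and `lin 1`. -/
noncomputable def point (u v : ℝ) : ℂ :=
  ⟨u * Real.cos (Real.pi / 7) - v, u * Real.sin (Real.pi / 7)⟩

lemma lin_point (m : ℕ) (u v : ℝ) : lin m (point u v) = sine m * v + sine (m + 6) * u := by
  have hs := sin_pi_div_seven_pos.ne'
  have h0 : lin 0 (point u v) = u := by rw [lin_zero]; simp [point, hs]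
  have h1 : lin 1 (point u v) = v := by rw [lin_one]; simp only [point]; field_simp; ring
  rw [lin_eq, h0, h1]

/-- The `k`-th power of the rotation by `-π / 7`. -/
noncomputable def turn (k : ℕ) : ℂ := Complex.exp (((-(k * (Real.pi / 7)) : ℝ) : ℂ) * Complex.I)

/-- Up to the factor sin(π/7), the m-th functional is the imaginary part of exp(-mπi/7) z, so
rotating adds indices. -/
lemma lin_turn_mul (m k : ℕ) (z : ℂ) : lin m (turn k * z) = lin (m + k) z := by
  have h : ((m + k : ℕ) : ℝ) * (Real.pi / 7) = m * (Real.pi / 7) + k * (Real.pi / 7) := by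
    push_cast; ring
  simp only [lin, turn, Complex.mul_re, Complex.mul_im, Complex.exp_ofReal_mul_I_re,
    Complex.exp_ofReal_mul_I_im, Real.cos_neg, Real.sin_neg, h, Real.sin_add, Real.cos_add]
  ring

lemma lin_conj {m n : ℕ} (h : (m + n) % 14 = 7) (z : ℂ) :
    lin m ((starRingEnd ℂ) z) = lin n z := by
  have hm : m + n = 14 * ((m + n) / 14) + 7 := by omega
  set q := (m + n) / 14
  have hn : (n : ℝ) * (Real.pi / 7) = (Real.pi - m * (Real.pi / 7)) + q * (2 * Real.pi) := by
    have : (m + n : ℝ) = 14 * q + 7 := by exact_mod_cast hm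
    linear_combination Real.pi / 7 * this
  simp only [lin, Complex.conj_re, Complex.conj_im, hn, Real.cos_add_nat_mul_two_pi,
    Real.sin_add_nat_mul_two_pi, Real.cos_pi_sub, Real.sin_pi_sub]
  ring

namespace Sim

/-- The similarity as a map of the plane. -/
noncomputable def act (φ : Sim) (z : ℂ) : ℂ :=
  φ.scale.val * (turn φ.rot * (if φ.refl then (starRingEnd ℂ) z else z)) + point φ.u.val φ.v.val

lemma lin_act (φ : Sim) (m : ℕ) (z : ℂ) :
    lin m (φ.act z) = φ.scale.val * lin (φ.dir m) z + (linZ m φ.u φ.v).val := by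
  rw [act, lin_add, lin_real_mul, lin_point, val_linZ, lin_turn_mul]
  congr 2
  unfold dir
  cases φ.refl
  · simp [lin_mod]
  · exact lin_conj (by simp; omega) z

lemma val_bound (φ : Sim) (m : ℕ) (s : Zt) :
    (φ.bound m s).val = φ.scale.val * s.val + (linZ m φ.u φ.v).val := by simp [bound]

lemma dir_comp (φ ψ : Sim) (m : ℕ) : (φ.comp ψ).dir m % 14 = ψ.dir (φ.dir m) % 14 := by
  unfold comp dir
  cases φ.refl <;> cases ψ.refl <;> simp <;> omega

lemma act_comp (φ ψ : Sim) (z : ℂ) : (φ.comp ψ).act z = φ.act (ψ.act z) := by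
  apply ext_lin
  · rw [lin_act, lin_act, lin_act, lin_congr (dir_comp φ ψ 0), val_linZ_zero, val_linZ_zero]
    simp only [comp, val_bound, Zt.val_mul, val_linZ_zero]
    ring
  · rw [lin_act, lin_act, lin_act, lin_congr (dir_comp φ ψ 1), val_linZ_one, val_linZ_one]
    simp only [comp, val_bound, Zt.val_mul, val_linZ_one]
    ring

lemma act_one (z : ℂ) : one.act z = z := by
  apply ext_lin <;> rw [lin_act, val_linZ] <;> simp [one, dir, Zt.val]

lemma act_pow (φ : Sim) (n : ℕ) (z : ℂ) : (φ.pow n).act z = φ.act^[n] z := by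
  induction n with
  | zero => exact act_one z
  | succ n ih => rw [pow, act_comp, ih, Function.iterate_succ_apply']

lemma act_surjective {φ : Sim} (h : φ.scale.val ≠ 0) : Function.Surjective φ.act := by
  intro z
  have ht : turn φ.rot ≠ 0 := Complex.exp_ne_zero _
  have hs : (φ.scale.val : ℂ) ≠ 0 := by exact_mod_cast h
  set w := (z - point φ.u.val φ.v.val) / (φ.scale.val * turn φ.rot)
  have hw : (φ.scale.val : ℂ) * (turn φ.rot * w) + point φ.u.val φ.v.val = z := by
    simp only [w]; field_simp; ring
  cases hr : φ.refl
  · exact ⟨w, by simp [act, hr, hw]⟩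
  · exact ⟨(starRingEnd ℂ) w, by simp [act, hr, hw]⟩

/-- The isometric part of a similarity. -/
noncomputable def isom (φ : Sim) : ℂ ≃ₗᵢ[ℝ] ℂ :=
  (if φ.refl then Complex.conjLIE else LinearIsometryEquiv.refl ℝ ℂ).trans
    (_root_.rotation (Circle.exp (-(φ.rot * (Real.pi / 7)))))

lemma isom_apply (φ : Sim) (z : ℂ) :
    φ.isom z = turn φ.rot * (if φ.refl then (starRingEnd ℂ) z else z) := by
  rw [isom, LinearIsometryEquiv.trans_apply, rotation_apply, Circle.coe_exp, turn]
  cases φ.refl <;> rfl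

open scoped Pointwise in
lemma volume_act_image (φ : Sim) (s : Set ℂ) :
    volume (φ.act '' s) = ENNReal.ofReal (φ.scale.val ^ 2) * volume s := by
  have h : φ.act '' s = (fun z => point φ.u.val φ.v.val + z) '' (φ.scale.val • (φ.isom '' s)) := by
    rw [← Set.image_smul, Set.image_image, Set.image_image]
    refine Set.image_congr fun z _ => ?_
    simp only [act, isom_apply, Complex.real_smul]
    ring
  rw [h, Set.image_add_left, measure_preimage_add, Measure.addHaar_smul, Complex.finrank_real_complex,
    abs_of_nonneg (sq_nonneg _)]
  congr 1
  have := φ.isom.symm.measurePreserving.measure_preimage_equiv (f := φ.isom.symm.toMeasurableEquiv) s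
  rw [← this]
  congr 1
  exact φ.isom.toEquiv.image_eq_preimage_symm s

end Sim

/-! ### Soundness of the polygon arithmetic -/

/-- The inequalities are strict, which keeps the points away from the edges, where the map is
arbitrary. -/
def region (P : Poly) : Set ℂ := {z | ∀ e ∈ P, lin e.1 z < e.2.val}

lemma lin_lt_of_lookup {m : ℕ} {b : Zt} {P : Poly} (h : lookup m P = some b) {z : ℂ}
    (hz : z ∈ region P) : lin m z < b.val := by
  induction P with
  | nil => simp [lookup] at h
  | cons e P ih =>
    rw [lookup] at h
    split at h
    · rename_i hm
      rw [← hm, ← Option.some_inj.1 h]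
      exact hz e (by simp)
    · exact ih h fun f hf => hz f (by simp [hf])

/-- When the outer directions differ by less than π, the middle functional is a combination of the
outer ones with positive coefficients. -/
lemma lin_lt_between {i p q : ℕ} {a b : Zt} (hp : 0 < p) (hq : 0 < q) (hpq : p + q < 7) {z : ℂ}
    (ha : lin i z < a.val) (hb : lin (i + p + q) z < b.val) :
    lin (i + p) z < (between p q a b).val := by
  have h := sine_mul_lin i p q z
  have h1 := sineInv_mul (n := p + q) (by omega) hpq
  have h2 : 0 < sine (p + q) := sine_pos (by omega) hpq
  have h3 : 0 < (sineInv (p + q)).val := by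
    by_contra! hn
    have := mul_nonpos_of_nonpos_of_nonneg hn h2.le
    linarith
  have h4 := mul_lt_mul_of_pos_left ha (sine_pos hq (by omega))
  have h5 := mul_lt_mul_of_pos_left hb (sine_pos hp (by omega))
  simp only [between, Zt.val_mul, Zt.val_add, val_sineZ]
  calc lin (i + p) z = (sineInv (p + q)).val * (sine (p + q) * lin (i + p) z) := by
        rw [← mul_assoc, h1, one_mul]
    _ < _ := mul_lt_mul_of_pos_left (by linarith) h3

lemma supportAt_spec {P : Poly} {m : ℕ} {L : List ((ℕ × Zt) × (ℕ × Zt))} {b : Zt}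
    (hL : ∀ x ∈ L, x.1 ∈ P ∧ x.2 ∈ P) (h : supportAt m L = some b) {z : ℂ} (hz : z ∈ region P) :
    lin m z < b.val := by
  induction L with
  | nil => simp [supportAt] at h
  | cons x L ih =>
    obtain ⟨e, f⟩ := x
    have he := hz e (hL (e, f) (by simp)).1
    have hf := hz f (hL (e, f) (by simp)).2
    rw [supportAt] at h
    split at h
    · rename_i hm
      rwa [← hm, ← Option.some_inj.1 h]
    · dsimp only at h
      split at h
      · rename_i hpq
        rw [← Option.some_inj.1 h]
        set p := (m + 13 * e.1) % 14 with hp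
        set q := (f.1 + 13 * m) % 14 with hq
        rw [lin_congr (n := e.1 + p) (by omega)]
        refine lin_lt_between hpq.1 hpq.2.1 hpq.2.2 he ?_
        rwa [lin_congr (n := f.1) (by omega)]
      · exact ih (fun x hx => hL x (by simp [hx])) h

/-- The entries of `s` bound the functionals on the polygon `P`. -/
def Supports (s : List Zt) (P : Poly) : Prop :=
  ∀ m b, s[m]? = some b → ∀ z ∈ region P, lin m z < b.val

lemma eq_map_some_of_collect {α : Type} {L : List (Option α)} {s : List α}
    (h : collect L = some s) : L = s.map some := by
  induction L generalizing s with
  | nil => simp_all [collect]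
  | cons o L ih =>
    cases o with
    | none => simp [collect] at h
    | some x =>
      rw [collect] at h
      split at h
      · simp at h
      · rename_i y hy
        rw [← Option.some_inj.1 h, ih hy, List.map_cons]

lemma support_spec {P : Poly} {s : List Zt} (h : support P = some s) :
    Supports s P ∧ s.length = 14 := by
  have h := eq_map_some_of_collect h
  refine ⟨fun m b hb z hz => ?_, by simpa using (congrArg List.length h).symm⟩
  have h2 := congrArg (fun L => L[m]?) h
  simp only [List.getElem?_map, hb, Option.map_some, Option.map_eq_some_iff] at h2
  obtain ⟨k, hk, hkb⟩ := h2
  obtain ⟨hm, rfl⟩ := List.getElem?_eq_some_iff.1 hk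
  rw [List.getElem_range] at hkb
  refine supportAt_spec (fun x hx => ?_) hkb hz
  have := List.of_mem_zip hx
  exact ⟨this.1, by simpa using this.2⟩

/-- Directions 0, 7 and 1, 8 are opposite pairs, so they bound both coordinates from both sides. -/
lemma volume_region_lt_top {P : Poly} (h : (support P).isSome = true) : volume (region P) < ⊤ := by
  obtain ⟨s, hs⟩ := Option.isSome_iff_exists.1 h
  obtain ⟨h, hlen⟩ := support_spec hs
  have hb : ∀ m : ℕ, m < 14 → ∃ b : ℝ, ∀ z ∈ region P, lin m z < b := fun m hm =>
    ⟨_, h m _ (List.getElem?_eq_getElem (by omega))⟩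
  obtain ⟨b0, h0⟩ := hb 0 (by norm_num)
  obtain ⟨b1, h1⟩ := hb 1 (by norm_num)
  obtain ⟨b7, h7⟩ := hb 7 (by norm_num)
  obtain ⟨b8, h8⟩ := hb 8 (by norm_num)
  refine Bornology.IsBounded.measure_lt_top ?_
  rw [isBounded_iff_forall_norm_le]
  set c := max b0 b7
  set d := max b1 b8
  refine ⟨c + d + c, fun z hz => ?_⟩
  have a0 := h0 z hz
  have a1 := h1 z hz
  have a7 := h7 z hz
  have a8 := h8 z hz
  rw [lin_add_seven 0] at a7
  rw [lin_add_seven 1] at a8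
  have c0 : |lin 0 z| ≤ c := abs_le.2 ⟨by linarith [le_max_right b0 b7], a0.le.trans (le_max_left _ _)⟩
  have c1 : |lin 1 z| ≤ d := abs_le.2 ⟨by linarith [le_max_right b1 b8], a1.le.trans (le_max_left _ _)⟩
  have hs := sin_pi_div_seven_pos
  have him : z.im = lin 0 z * Real.sin (Real.pi / 7) := by rw [lin_zero]; field_simp
  have hre : z.re = lin 0 z * Real.cos (Real.pi / 7) - lin 1 z := by
    rw [lin_zero, lin_one]; field_simp; ring
  have e1 : |z.im| ≤ c := by
    rw [him, abs_mul]
    exact (mul_le_of_le_one_right (abs_nonneg _) (Real.abs_sin_le_one _)).trans c0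
  have e2 : |z.re| ≤ c + d := by
    rw [hre]
    refine (abs_sub _ _).trans (add_le_add ?_ c1)
    rw [abs_mul]
    exact (mul_le_of_le_one_right (abs_nonneg _) (Real.abs_cos_le_one _)).trans c0
  exact (Complex.norm_le_abs_re_add_abs_im z).trans (add_le_add e2 e1)

lemma act_mem_of_fits {s : List Zt} {P Q : Poly} {φ : Sim} (hs : Supports s P)
    (hφ : 0 < φ.scale.val) (h : fits s φ Q = true) {z : ℂ} (hz : z ∈ region P) :
    φ.act z ∈ region Q := by
  intro e he
  have h1 := List.all_eq_true.1 h e he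
  split at h1
  · simp at h1
  · rename_i b hb
    have h2 := Zt.val_le h1
    have h3 := mul_lt_mul_of_pos_left (hs _ _ hb z hz) hφ
    rw [Sim.val_bound] at h2
    rw [Sim.lin_act]
    linarith

lemma exists_act_eq_of_mem_push {φ : Sim} {P : Poly} (hφ : 0 < φ.scale.val) {z : ℂ}
    (hz : z ∈ region (push φ P)) : ∃ w ∈ region P, φ.act w = z := by
  obtain ⟨w, rfl⟩ := Sim.act_surjective hφ.ne' z
  refine ⟨w, fun e he => ?_, rfl⟩
  have h := hz _ (List.mem_map_of_mem he)
  dsimp only at h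
  have hd : φ.dir (φ.dirInv e.1) % 14 = e.1 % 14 := by
    unfold Sim.dir Sim.dirInv
    cases φ.refl <;> simp <;> omega
  rw [Sim.lin_act, Sim.val_bound, lin_congr hd] at h
  exact lt_of_mul_lt_mul_left (by linarith) hφ.le

/-- A point is generic if it lies on no line with coefficients in `ℤ[τ]`. -/
def Generic (z : ℂ) : Prop := ∀ (m : ℕ) (b : Zt), lin m z ≠ b.val

lemma not_mem_of_excluded {p q m : ℕ} {b : Zt} {R : Poly} (h : excluded p q m b R = true) {z : ℂ}
    (hz : z ∈ region R) (hb : lin m z < b.val) : False := by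
  unfold excluded at h
  split at h
  · split at h
    · simp at h
    · rename_i c hc
      have h1 := lin_lt_of_lookup hc hz
      have h2 := Zt.val_le h
      rw [lin_mod, lin_add_seven] at h1
      rw [Zt.val_neg] at h2
      linarith
  · rename_i hp
    split at h
    · rename_i c d hc hd
      simp only [Bool.and_eq_true, decide_eq_true_eq] at h
      obtain ⟨⟨hq, hpq⟩, hle⟩ := h
      have h1 := lin_lt_of_lookup hc hz
      have h2 := lin_lt_of_lookup hd hz
      rw [lin_congr (n := m + 7 + 13 * p + p + q) (by omega)] at h2
      rw [lin_mod] at h1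
      have h3 := lin_lt_between (Nat.pos_of_ne_zero hp) hq hpq h1 h2
      have h4 := Zt.val_le hle
      rw [lin_congr (n := m + 7) (by omega), lin_add_seven] at h3
      rw [Zt.val_neg] at h4
      linarith
    · simp at h

/-- Induction on the certificate: a generic point lies strictly on one side of each cutting line,
which selects the branch to follow. -/
lemma exists_floor_of_covered {F : List Floor} {tag : ℕ} {c : Cover} {R : Poly}
    (h : covered F tag c R = true) {z : ℂ} (hz : z ∈ region R) (hg : Generic z) :
    ∃ x ∈ F, x.tag = tag ∧ z ∈ region (push x.sim x.base) := by
  induction c generalizing R with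
  | empty p q =>
    unfold covered at h
    split at h
    · simp at h
    · rename_i e R'
      exact (not_mem_of_excluded h (fun f hf => hz f (by simp [hf])) (hz e (by simp))).elim
  | inside f =>
    unfold covered at h
    split at h
    · simp at h
    · rename_i x hx
      simp only [Bool.and_eq_true, beq_iff_eq, List.all_eq_true] at h
      refine ⟨x, List.mem_of_getElem? hx, h.1, fun e he => ?_⟩
      have h1 := h.2 e he
      split at h1
      · simp at h1
      · rename_i b hb
        exact (lin_lt_of_lookup hb hz).trans_le (Zt.val_le h1)
  | cut f m out inn iho ihi =>
    unfold covered at h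
    split at h
    · simp at h
    · rename_i x hx
      split at h
      · simp at h
      · rename_i b hb
        simp only [Bool.and_eq_true] at h
        rcases lt_or_gt_of_ne (hg m b) with hlt | hgt
        · refine ihi h.2 fun e he => ?_
          rcases List.mem_cons.1 he with rfl | he
          · exact hlt
          · exact hz e he
        · refine iho h.1 fun e he => ?_
          rcases List.mem_cons.1 he with rfl | he
          · rw [lin_mod, lin_add_seven, Zt.val_neg]
            linarith
          · exact hz e he

/-! ### Soundness of renormalisation schemes -/

/-- The pieces `As`, placed by `g`, are moved according to iterates of `T`. -/
def Realised (T : ℂ → ℂ) (As : List Piece) (g : ℂ → ℂ) : Prop :=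
  ∀ A ∈ As, ∃ n, 0 < n ∧ ∀ z ∈ region A.edges, T^[n] (g z) = g (A.move.act z)

/-- Each letter costs a positive number of iterates of `T`, so the total is at least the length of
the word; for a nonempty word the return time is positive. -/
lemma walk_spec {T : ℂ → ℂ} {As : List Piece} {g : ℂ → ℂ} (hg : Realised T As g) {s : List Zt}
    {P : Poly} (hs : Supports s P) {w : List ℕ} {φ ψ : Sim} {F : List (ℕ × Sim)}
    (h : walk As s φ w = some (F, ψ)) (hF : ∀ x ∈ F, x.2.scale.pos = true) :
    (∃ n, w.length ≤ n ∧ ∀ z ∈ region P, T^[n] (g (φ.act z)) = g (ψ.act z)) ∧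
      ∀ x ∈ F, ∃ n, ∀ z ∈ region P, T^[n] (g (φ.act z)) = g (x.2.act z) := by
  induction w generalizing φ F with
  | nil =>
    simp only [walk, Option.some.injEq, Prod.mk.injEq] at h
    obtain ⟨rfl, rfl⟩ := h
    exact ⟨⟨0, le_rfl, fun _ _ => rfl⟩, by simp⟩
  | cons i w ih =>
    rw [walk] at h
    split at h
    · simp at h
    · rename_i A hA
      split at h
      · rename_i hfit
        split at h
        · simp at h
        · rename_i F' ψ' hw
          simp only [Option.some.injEq, Prod.mk.injEq] at h
          obtain ⟨rfl, rfl⟩ := h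
          obtain ⟨n, hn, hT⟩ := hg A (List.mem_of_getElem? hA)
          have hφ := Zt.val_pos (hF (i, φ) (by simp))
          have hstep : ∀ z ∈ region P, T^[n] (g (φ.act z)) = g ((A.move.comp φ).act z) :=
            fun z hz => by rw [hT _ (act_mem_of_fits hs hφ hfit hz), Sim.act_comp]
          obtain ⟨⟨k, hk, hk'⟩, h2⟩ := ih hw fun x hx => hF x (by simp [hx])
          refine ⟨⟨k + n, by simp; omega, fun z hz => ?_⟩, fun x hx => ?_⟩
          · rw [Function.iterate_add_apply, hstep z hz, hk' z hz]
          · rcases List.mem_cons.1 hx with rfl | hx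
            · exact ⟨0, fun _ _ => rfl⟩
            · obtain ⟨k, hk⟩ := h2 x hx
              exact ⟨k + n, fun z hz => by
                rw [Function.iterate_add_apply, hstep z hz, hk z hz]⟩
      · simp at h

lemma iterate_mem_periodicPts {T : ℂ → ℂ} {z : ℂ} (h : z ∈ Function.periodicPts T) (n : ℕ) :
    T^[n] z ∈ Function.periodicPts T := by
  obtain ⟨k, hk, hz⟩ := h
  exact ⟨k, hk, hz.apply_iterate n⟩

/-- What the floors of a scheme realised by `g` have to satisfy. -/
def IsFloor (T : ℂ → ℂ) (sys : List Scheme) (g : ℂ → ℂ) (x : Floor) : Prop :=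
  0 < x.sim.scale.val ∧
    ((∀ z ∈ region x.base, g (x.sim.act z) ∈ Function.periodicPts T) ∨
      ∃ S ∈ sys, ∃ h, Realised T S.pieces h ∧ ∃ B ∈ S.pieces, x.base = B.edges ∧
        x.weight = B.weight ∧ ∀ z ∈ region x.base, h z ∈ Function.periodicPts T →
          g (x.sim.act z) ∈ Function.periodicPts T)

/-- Since the return map ψ keeps the cell, successive returns realise its powers and the seventh is
the identity. Points of higher floors are forward images of these periodic points. -/
lemma isFloor_of_mem_cellFloors {T : ℂ → ℂ} {sys : List Scheme} {As : List Piece} {g : ℂ → ℂ}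
    (hg : Realised T As g) {c : Cell} {F : List Floor} (h : cellFloors As c = some F) {x : Floor}
    (hx : x ∈ F) : IsFloor T sys g x := by
  unfold cellFloors at h
  split at h
  · simp at h
  rename_i s hs
  have hs := (support_spec hs).1
  split at h
  · simp at h
  rename_i G ψ hw
  split at h
  swap
  · simp at h
  rename_i hc
  obtain ⟨hne, hpos, hfit, hpow, hall⟩ := hc
  rw [← Option.some_inj.1 h] at hx
  obtain ⟨y, hy, rfl⟩ := List.mem_map.1 hx
  rw [List.all_eq_true] at hall
  obtain ⟨⟨n, hn, hT⟩, h2⟩ := walk_spec hg hs hw hall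
  have hn : 0 < n := (List.length_pos_iff.2 hne).trans_le hn
  refine ⟨Zt.val_pos (hall y hy), Or.inl fun z hz => ?_⟩
  dsimp only at hz ⊢
  have hiter : ∀ j : ℕ, ψ.act^[j] z ∈ region c.edges ∧ T^[n * j] (g z) = g (ψ.act^[j] z) := by
    intro j
    induction j with
    | zero => exact ⟨hz, rfl⟩
    | succ j ih =>
      rw [Function.iterate_succ_apply', Nat.mul_succ, add_comm, Function.iterate_add_apply, ih.2]
      refine ⟨act_mem_of_fits hs (Zt.val_pos hpos) hfit ih.1, ?_⟩
      rw [← hT _ ih.1, Sim.act_one]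
  have hper : g z ∈ Function.periodicPts T := by
    refine ⟨n * 7, by omega, ?_⟩
    rw [Function.IsPeriodicPt, Function.IsFixedPt, (hiter 7).2, ← Sim.act_pow, hpow, Sim.act_one]
  obtain ⟨k, hk⟩ := h2 y hy
  rw [← hk z hz, Sim.act_one]
  exact iterate_mem_periodicPts hper k

/-- The first half makes the copy a realised scheme. The second passes periodicity from base to
floor, so a nonperiodic floor point has a nonperiodic base point. -/
lemma pieceFloors_spec {T : ℂ → ℂ} {As : List Piece} {g : ℂ → ℂ} (hg : Realised T As g) {φ : Sim}
    {B : Piece} {w : List ℕ} {F : List Floor} (h : pieceFloors As φ B w = some F) :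
    (∃ n, 0 < n ∧ ∀ z ∈ region B.edges, T^[n] (g (φ.act z)) = g (φ.act (B.move.act z))) ∧
      ∀ x ∈ F, 0 < x.sim.scale.val ∧ x.base = B.edges ∧ x.weight = B.weight ∧
        ∀ z ∈ region x.base, g (φ.act z) ∈ Function.periodicPts T →
          g (x.sim.act z) ∈ Function.periodicPts T := by
  unfold pieceFloors at h
  split at h
  · simp at h
  rename_i s hs
  have hs := (support_spec hs).1
  split at h
  · simp at h
  rename_i G ψ hw
  split at h
  swap
  · simp at h
  rename_i hc
  obtain ⟨hne, rfl, hall⟩ := hc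
  rw [List.all_eq_true] at hall
  obtain ⟨⟨n, hn, hT⟩, h2⟩ := walk_spec hg hs hw hall
  refine ⟨⟨n, (List.length_pos_iff.2 hne).trans_le hn, fun z hz => ?_⟩, fun x hx => ?_⟩
  · rw [hT z hz, Sim.act_comp]
  · rw [← Option.some_inj.1 h] at hx
    obtain ⟨y, hy, rfl⟩ := List.mem_map.1 hx
    refine ⟨Zt.val_pos (hall y hy), rfl, rfl, fun z hz hp => ?_⟩
    obtain ⟨k, hk⟩ := h2 y hy
    rw [← hk z hz]
    exact iterate_mem_periodicPts hp k

lemma gather_spec {α : Type} {L : List (Option (List α))} {y : List α} (h : gather L = some y) :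
    (∀ o ∈ L, ∃ x, o = some x) ∧ ∀ a ∈ y, ∃ x, some x ∈ L ∧ a ∈ x := by
  obtain ⟨s, hs, rfl⟩ := Option.map_eq_some_iff.1 h
  rw [eq_map_some_of_collect hs]
  refine ⟨fun o ho => ?_, fun a ha => ?_⟩
  · obtain ⟨x, -, rfl⟩ := List.mem_map.1 ho
    exact ⟨x, rfl⟩
  · obtain ⟨x, hx, hax⟩ := List.mem_flatten.1 ha
    exact ⟨x, List.mem_map_of_mem hx, hax⟩

lemma mem_zipWith {α β γ : Type} {f : α → β → γ} {l : List α} {m : List β} {c : γ}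
    (h : c ∈ List.zipWith f l m) : ∃ a ∈ l, ∃ b ∈ m, f a b = c := by
  rw [← List.map_uncurry_zip_eq_zipWith] at h
  obtain ⟨⟨a, b⟩, hab, rfl⟩ := List.mem_map.1 h
  exact ⟨a, (List.of_mem_zip hab).1, b, (List.of_mem_zip hab).2, rfl⟩

lemma exists_mem_zipWith {α β γ : Type} {f : α → β → γ} {l : List α} {m : List β}
    (hlen : m.length = l.length) {a : α} (ha : a ∈ l) : ∃ b ∈ m, f a b ∈ List.zipWith f l m := by
  obtain ⟨i, hi, rfl⟩ := List.getElem_of_mem ha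
  refine ⟨m[i], List.getElem_mem _, ?_⟩
  rw [← List.getElem_zipWith (f := f) (h := by simp; omega)]
  exact List.getElem_mem _

lemma isFloor_of_mem_linkFloors {T : ℂ → ℂ} {sys : List Scheme} {As : List Piece} {g : ℂ → ℂ}
    (hg : Realised T As g) {k : Link} {F : List Floor} (h : linkFloors sys As k = some F)
    {x : Floor} (hx : x ∈ F) : IsFloor T sys g x := by
  unfold linkFloors at h
  split at h
  · simp at h
  rename_i S hS
  split at h
  swap
  · simp at h
  rename_i hlen
  obtain ⟨h1, h2⟩ := gather_spec h
  -- The copy is realised by the same `T`; only the placement changes.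
  have hr : Realised T S.pieces (g ∘ k.sim.act) := by
    intro B hB
    obtain ⟨w, -, hw⟩ := exists_mem_zipWith (f := pieceFloors As k.sim) hlen hB
    obtain ⟨G, hG⟩ := h1 _ hw
    exact (pieceFloors_spec hg hG).1
  obtain ⟨G, hG, hxG⟩ := h2 x hx
  obtain ⟨B, hB, w, -, hw⟩ := mem_zipWith hG
  obtain ⟨hpos, hb, hwt, hp⟩ := (pieceFloors_spec hg hw).2 x hxG
  exact ⟨hpos, Or.inr ⟨S, List.mem_of_getElem? hS, _, hr, B, hB, hb, hwt, hp⟩⟩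

lemma isFloor_of_mem_floors {T : ℂ → ℂ} {sys : List Scheme} {S : Scheme} {g : ℂ → ℂ}
    (hg : Realised T S.pieces g) {F : List Floor} (h : floors sys S = some F) {x : Floor}
    (hx : x ∈ F) : IsFloor T sys g x := by
  obtain ⟨G, hG, hxG⟩ := (gather_spec h).2 x hx
  rcases List.mem_append.1 hG with hG | hG
  · obtain ⟨k, -, hk⟩ := List.mem_map.1 hG
    exact isFloor_of_mem_linkFloors hg hk hxG
  · obtain ⟨c, -, hc⟩ := List.mem_map.1 hG
    exact isFloor_of_mem_cellFloors hg hc hxG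

/-! ### The measure of the set of nonperiodic points -/

/-- A level set is a translate of the kernel, a proper subspace. -/
lemma ae_lin_ne (m : ℕ) (b : ℝ) : ∀ᵐ z : ℂ, lin m z ≠ b := by
  have hs := sin_pi_div_seven_pos.ne'
  let L : ℂ →ₗ[ℝ] ℝ :=
    { toFun := lin m
      map_add' := lin_add m
      map_smul' := fun r z => by simpa using lin_real_mul m r z }
  obtain ⟨q, hq⟩ : ∃ q, lin m q = 1 := by
    refine ⟨(Real.sin (Real.pi / 7) : ℂ) * ⟨-Real.sin (m * (Real.pi / 7)),
      Real.cos (m * (Real.pi / 7))⟩, ?_⟩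
    rw [lin_real_mul, lin, mul_div_cancel₀ _ hs]
    linear_combination Real.sin_sq_add_cos_sq (m * (Real.pi / 7))
  have hne : LinearMap.ker L ≠ ⊤ := fun h => by
    have h2 : L q = 0 := LinearMap.mem_ker.1 (h ▸ Submodule.mem_top)
    exact one_ne_zero (hq.symm.trans h2)
  have h0 := Measure.addHaar_submodule volume _ hne
  have h2 : {z : ℂ | lin m z = b} = (fun z => -(b * q) + z) ⁻¹' (LinearMap.ker L : Set ℂ) := by
    ext z
    have : L (-(b * q) + z) = -b + lin m z := by
      rw [map_add, map_neg]
      exact congrArg (fun t => -t + lin m z) ((lin_real_mul m b q).trans (by rw [hq, mul_one]))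
    simp only [Set.mem_ofPred_eq, Set.mem_preimage, SetLike.mem_coe, LinearMap.mem_ker, this]
    constructor <;> intro h <;> linarith
  rw [ae_iff]
  simp only [ne_eq, not_not]
  rw [h2, measure_preimage_add, h0]

lemma ae_generic : ∀ᵐ z : ℂ, Generic z := by
  have : Countable Zt := Function.Injective.countable (f := fun x : Zt => (x.a, x.b, x.d))
    fun x y h => by cases x; cases y; simp_all
  simp only [Generic, ae_all_iff]
  exact fun m b => ae_lin_ne m b.val

lemma load_nonneg (tag : ℕ) (F : List Floor) : 0 ≤ (load tag F).val := by
  induction F with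
  | nil => simp [load, Zt.val]
  | cons x F ih =>
    rw [load]
    split
    · simp only [Zt.val_add, Zt.val_mul, Zt.val_ofNat]
      exact add_nonneg (mul_nonneg (mul_self_nonneg _) (Nat.cast_nonneg _)) ih
    · exact ih

lemma volume_floors_le {F : List Floor} {tag : ℕ} {p : Floor → Set ℂ} {K : ℝ} (hK : 0 ≤ K)
    (h : ∀ x ∈ F, volume (p x) ≤ ENNReal.ofReal (x.sim.scale.val ^ 2 * (K * x.weight))) :
    volume {z | ∃ x ∈ F, x.tag = tag ∧ z ∈ p x} ≤ ENNReal.ofReal (K * (load tag F).val) := by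
  induction F with
  | nil => simp
  | cons x F ih =>
    have ih := ih fun y hy => h y (by simp [hy])
    rw [load]
    split
    · rename_i ht
      refine (measure_mono (t := p x ∪ {z | ∃ x ∈ F, x.tag = tag ∧ z ∈ p x}) ?_).trans
        ((measure_union_le _ _).trans ((add_le_add (h x (by simp)) ih).trans ?_))
      · rintro z ⟨y, hy, hyt, hz⟩
        rcases List.mem_cons.1 hy with rfl | hy
        · exact Or.inl hz
        · exact Or.inr ⟨y, hy, hyt, hz⟩
      · rw [← ENNReal.ofReal_add (by positivity) (mul_nonneg hK (load_nonneg _ _))]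
        refine ENNReal.ofReal_le_ofReal (le_of_eq ?_)
        simp only [Zt.val_add, Zt.val_mul, Zt.val_ofNat]
        ring
    · rename_i ht
      refine (measure_mono ?_).trans ih
      rintro z ⟨y, hy, hyt, hz⟩
      rcases List.mem_cons.1 hy with rfl | hy
      · exact absurd hyt ht
      · exact ⟨y, hy, hyt, hz⟩

/-- The points of a piece that `g` places at nonperiodic points. -/
def bad (T g : ℂ → ℂ) (P : Poly) : Set ℂ := {z ∈ region P | g z ∉ Function.periodicPts T}

/-- The sets of nonperiodic points are bounded by `K` times the weights. -/
def Bounded (T : ℂ → ℂ) (sys : List Scheme) (K : ℝ) : Prop :=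
  ∀ S ∈ sys, ∀ g, Realised T S.pieces g → ∀ A ∈ S.pieces,
    volume (bad T g A.edges) ≤ ENNReal.ofReal (K * A.weight)

/-- Nonperiodic points of a floor are images of nonperiodic points of its base, and the similarity
multiplies area by the squared scale. -/
lemma volume_floor_le {T : ℂ → ℂ} {sys : List Scheme} {g : ℂ → ℂ} {x : Floor}
    (hx : IsFloor T sys g x) {K : ℝ} (h : Bounded T sys K) :
    volume (bad T g (push x.sim x.base)) ≤
      ENNReal.ofReal (x.sim.scale.val ^ 2 * (K * x.weight)) := by
  obtain ⟨hpos, hx⟩ := hx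
  rcases hx with hx | ⟨S, hS, f, hf, B, hB, hb, hw, hp⟩
  · have : bad T g (push x.sim x.base) = ∅ := by
      refine Set.eq_empty_of_forall_notMem ?_
      rintro z ⟨hz, hbad⟩
      obtain ⟨w, hw, rfl⟩ := exists_act_eq_of_mem_push hpos hz
      exact hbad (hx w hw)
    rw [this, measure_empty]
    exact zero_le
  · refine (measure_mono (t := x.sim.act '' bad T f B.edges) ?_).trans ?_
    · rintro z ⟨hz, hbad⟩
      obtain ⟨w, hw, rfl⟩ := exists_act_eq_of_mem_push hpos hz
      exact ⟨w, ⟨hb ▸ hw, fun h => hbad (hp w hw h)⟩, rfl⟩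
    · rw [Sim.volume_act_image, ENNReal.ofReal_mul (sq_nonneg _), hw]
      gcongr
      exact h S hS f hf B hB

lemma checkPiece_of_mem {sys : List Scheme} {S : Scheme} (h : checkScheme sys S = true) {A : Piece}
    (hA : A ∈ S.pieces) : ∃ F k c, floors sys S = some F ∧ checkPiece F k A c = true := by
  unfold checkScheme at h
  split at h
  · simp at h
  rename_i F hF
  obtain ⟨k, hk, rfl⟩ := List.getElem_of_mem hA
  have h := List.all_eq_true.1 h k (by simpa using hk)
  split at h
  · rename_i A c hA hc
    rw [List.getElem?_eq_getElem hk, Option.some_inj] at hA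
    exact ⟨F, k, c, hF, hA ▸ h⟩
  · simp at h

/-- The contraction step. The hypothesis covers all placements, hence also those of the copies;
summing over the floors in a piece gives K times its load. -/
lemma Bounded.mul {T : ℂ → ℂ} {sys : List Scheme} (hsys : ∀ S ∈ sys, checkScheme sys S = true)
    {K : ℝ} (hK : 0 ≤ K) (h : Bounded T sys K) : Bounded T sys (K * (9 / 10)) := by
  intro S hS g hg A hA
  obtain ⟨F, k, c, hF, hc⟩ := checkPiece_of_mem (hsys S hS) hA
  simp only [checkPiece, Bool.and_eq_true] at hc
  obtain ⟨⟨-, hload⟩, hcov⟩ := hc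
  have hload := Zt.val_le hload
  simp only [Zt.val_mul, Zt.val_ofNat] at hload
  push_cast at hload
  calc volume (bad T g A.edges)
      ≤ volume {z | ∃ x ∈ F, x.tag = k ∧ z ∈ bad T g (push x.sim x.base)} := by
        refine measure_mono_ae ?_
        filter_upwards [ae_generic] with z hz
        rintro ⟨hzA, hbad⟩
        obtain ⟨x, hx, hk, hzx⟩ := exists_floor_of_covered hcov hzA hz
        exact ⟨x, hx, hk, hzx, hbad⟩
    _ ≤ ENNReal.ofReal (K * (load k F).val) :=
        volume_floors_le hK fun x hx => volume_floor_le (isFloor_of_mem_floors hg hF hx) h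
    _ ≤ _ := ENNReal.ofReal_le_ofReal (by nlinarith)

lemma exists_forall_le {α : Type} (L : List α) (f : α → ℝ) : ∃ K, 0 ≤ K ∧ ∀ a ∈ L, f a ≤ K := by
  induction L with
  | nil => exact ⟨0, le_rfl, by simp⟩
  | cons b L ih =>
    obtain ⟨K, hK, h⟩ := ih
    refine ⟨max K (f b), hK.trans (le_max_left _ _), fun a ha => ?_⟩
    rcases List.mem_cons.1 ha with rfl | ha
    · exact le_max_right _ _
    · exact (h a ha).trans (le_max_left _ _)

/-- The largest area of a piece serves as K, since the weights are at least 1. -/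
lemma exists_bounded (T : ℂ → ℂ) {sys : List Scheme}
    (hsys : ∀ S ∈ sys, checkScheme sys S = true) : ∃ K, 0 ≤ K ∧ Bounded T sys K := by
  obtain ⟨K, hK, h⟩ := exists_forall_le (sys.flatMap Scheme.pieces)
    fun A => (volume (region A.edges)).toReal
  refine ⟨K, hK, fun S hS g _ A hA => ?_⟩
  obtain ⟨F, k, c, -, hc⟩ := checkPiece_of_mem (hsys S hS) hA
  simp only [checkPiece, Bool.and_eq_true, decide_eq_true_eq] at hc
  obtain ⟨⟨⟨hs, hw⟩, -⟩, -⟩ := hc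
  have hw : (1 : ℝ) ≤ A.weight := by exact_mod_cast hw
  calc volume (bad T g A.edges) ≤ volume (region A.edges) := measure_mono fun z hz => hz.1
    _ = ENNReal.ofReal (volume (region A.edges)).toReal :=
        (ENNReal.ofReal_toReal (volume_region_lt_top hs).ne).symm
    _ ≤ _ := ENNReal.ofReal_le_ofReal
        ((h A (List.mem_flatMap.2 ⟨S, hS, hA⟩)).trans (le_mul_of_one_le_right hK hw))

/-- In a system of schemes that passes the check, almost all points are periodic. -/
theorem volume_bad_eq_zero {T : ℂ → ℂ} {sys : List Scheme}
    (hsys : ∀ S ∈ sys, checkScheme sys S = true) {S : Scheme} (hS : S ∈ sys) {g : ℂ → ℂ}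
    (hg : Realised T S.pieces g) {A : Piece} (hA : A ∈ S.pieces) :
    volume (bad T g A.edges) = 0 := by
  obtain ⟨K, hK, h⟩ := exists_bounded T hsys
  have hn : ∀ n : ℕ, Bounded T sys (K * (9 / 10) ^ n) := by
    intro n
    induction n with
    | zero => simpa using h
    | succ n ih =>
      have := ih.mul hsys (by positivity)
      rwa [mul_assoc, ← pow_succ] at this
  have ht : Filter.Tendsto (fun n : ℕ => ENNReal.ofReal (K * (9 / 10) ^ n * A.weight))
      Filter.atTop (nhds 0) := by
    rw [← ENNReal.ofReal_zero]
    refine (ENNReal.continuous_ofReal.tendsto _).comp ?_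
    have := ((tendsto_pow_atTop_nhds_zero_of_lt_one (r := (9 / 10 : ℝ)) (by norm_num)
      (by norm_num)).const_mul K).mul_const (A.weight : ℝ)
    simpa using this
  exact le_antisymm (ge_of_tendsto' ht fun n => hn n S hS g hg A hA) (zero_le)

/-! ### The lozenge -/

lemma isOpen_region (P : Poly) : IsOpen (region P) := by
  have h : region P = ⋂ e ∈ {e | e ∈ P}, {z | lin e.1 z < e.2.val} := by
    ext z; simp [region]
  rw [h]
  refine (List.finite_toSet P).isOpen_biInter fun e _ => isOpen_lt ?_ continuous_const
  unfold lin
  fun_prop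

lemma lin_le_of_mem_convexHull {m : ℕ} {b : ℝ} {s : Set ℂ} (h : ∀ v ∈ s, lin m v ≤ b) {z : ℂ}
    (hz : z ∈ convexHull ℝ s) : lin m z ≤ b := by
  refine convexHull_min (t := {z | lin m z ≤ b}) h ?_ hz
  exact convex_halfSpace_le ⟨lin_add m, fun r z => by simpa using lin_real_mul m r z⟩ b

lemma lin_unit (m : ℕ) : lin m 1 = -sine m := by simp [lin, sine, neg_div]

lemma zeta_inv : ζ⁻¹ = turn 4 := by
  rw [ζ, ← Complex.exp_neg, turn]
  congr 1
  push_cast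
  ring

lemma lin_zeta_inv (m : ℕ) : lin m ζ⁻¹ = -sine (m + 4) := by
  rw [zeta_inv, ← mul_one (turn 4), lin_turn_mul, lin_unit]

lemma lin_zeta (m : ℕ) : lin m ζ = -sine (m + 10) := by
  have h : ((m + 10 : ℕ) : ℝ) * (Real.pi / 7) =
      m * (Real.pi / 7) - 4 * Real.pi / 7 + 2 * Real.pi := by
    push_cast; ring
  rw [sine, h, Real.sin_add_two_pi, Real.sin_sub, lin, ζ, Complex.exp_ofReal_mul_I_re,
    Complex.exp_ofReal_mul_I_im]
  ring

/-- This expresses the vertices containing ζ⁻¹ in the real basis 1, ζ. -/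
lemma zeta_add_zeta_inv : ζ + ζ⁻¹ = ((-1 / (tau ^ 2 - 1) : ℝ) : ℂ) := by
  have ht := tau_gt
  have h0 : tau ^ 2 - 1 ≠ 0 := by nlinarith
  rw [← mul_one ((_ : ℝ) : ℂ)]
  apply ext_lin <;> rw [lin_add, lin_zeta, lin_zeta_inv, lin_real_mul, lin_unit] <;>
    simp only [← val_sineZ] <;> simp [sineZ, Zt.val]
  · field_simp
    ring
  · field_simp
    linear_combination tau * tau_cubic

/-- Coordinates with respect to `1` and `ζ`. -/
lemma eq_add_mul_zeta (z : ℂ) :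
    z = ((-lin 4 z / (tau ^ 2 - 1) : ℝ) : ℂ) * 1 + ((lin 0 z / (tau ^ 2 - 1) : ℝ) : ℂ) * ζ := by
  have ht := tau_gt
  have h0 : tau ^ 2 - 1 ≠ 0 := by nlinarith
  apply ext_lin <;> rw [lin_add, lin_real_mul, lin_real_mul, lin_zeta, lin_unit] <;>
    simp only [lin_eq 4 z, ← val_sineZ] <;> simp [sineZ, Zt.val] <;> field_simp <;> ring

lemma lin_neg (m : ℕ) (z : ℂ) : lin m (-z) = -lin m z := by
  simpa using lin_real_mul m (-1) z

lemma lin_map_zero (m : ℕ) : lin m 0 = 0 := by simpa using lin_real_mul m 0 0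

lemma mem_triangle {x y : ℝ} (hy : y ≤ 1) (hx : 1 ≤ x) (hxy : (tau ^ 2 - 1) * (x - 1) ≤ y) :
    (x : ℂ) * 1 + y * ζ ∈ triangle := by
  have ht := tau_gt
  have h0 : 0 < tau ^ 2 - 1 := by nlinarith
  have hz : ζ⁻¹ = ((-1 / (tau ^ 2 - 1) : ℝ) : ℂ) - ζ := by rw [← zeta_add_zeta_inv]; ring
  have h := (convex_convexHull ℝ ({1, 1 + ζ, 1 - ζ⁻¹} : Set ℂ)).sum_mem (t := Finset.univ)
    -- The barycentric coordinates of the point.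
    (w := ![1 - y, y - (tau ^ 2 - 1) * (x - 1), (tau ^ 2 - 1) * (x - 1)])
    (z := ![1, 1 + ζ, 1 - ζ⁻¹])
    (by
      intro i _
      fin_cases i
      · simpa using hy
      · simpa using hxy
      · exact mul_nonneg h0.le (by linarith))
    (by simp [Fin.sum_univ_three])
    (by
      intro i _
      apply subset_convexHull
      fin_cases i <;> simp)
  rw [triangle]
  convert h using 1
  have h1 : (tau : ℂ) ^ 2 - 1 ≠ 0 := by exact_mod_cast h0.ne'
  simp only [Fin.sum_univ_three, hz, Complex.real_smul, Matrix.cons_val_zero, Matrix.cons_val_one,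
    Matrix.cons_val]
  push_cast
  field_simp
  ring

lemma mem_trapezium {x y : ℝ} (hy0 : 0 ≤ y) (hy : y ≤ 1) (hx : x ≤ 1)
    (hxy : y ≤ (tau ^ 2 - 1) * x) : (x : ℂ) * 1 + y * ζ ∈ trapezium := by
  have ht := tau_gt
  have h0 : 1 < tau ^ 2 - 1 := by nlinarith
  have hz : ζ⁻¹ = ((-1 / (tau ^ 2 - 1) : ℝ) : ℂ) - ζ := by rw [← zeta_add_zeta_inv]; ring
  have hd : 0 < tau ^ 2 - 1 - y := by linarith
  -- The point divides the chord parallel to the bases, from -yζ⁻¹ to 1 + yζ, in the ratio t : 1 -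
  -- t. The weights below are the resulting bilinear ones.
  set t := ((tau ^ 2 - 1) * x - y) / (tau ^ 2 - 1 - y) with htdef
  have ht0 : 0 ≤ t := div_nonneg (by linarith) hd.le
  have ht1 : t ≤ 1 := by rw [htdef, div_le_one hd]; nlinarith
  have h := (convex_convexHull ℝ ({0, 1, 1 + ζ, -ζ⁻¹} : Set ℂ)).sum_mem (t := Finset.univ)
    (w := ![(1 - t) * (1 - y), t * (1 - y), t * y, (1 - t) * y])
    (z := ![0, 1, 1 + ζ, -ζ⁻¹])
    (by
      intro i _
      fin_cases i
      · exact mul_nonneg (by linarith) (by linarith)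
      · exact mul_nonneg ht0 (by linarith)
      · exact mul_nonneg ht0 hy0
      · exact mul_nonneg (by linarith) hy0)
    (by simp [Fin.sum_univ_four]; ring)
    (by
      intro i _
      apply subset_convexHull
      fin_cases i <;> simp)
  rw [trapezium]
  convert h using 1
  have h1 : (tau : ℂ) ^ 2 - 1 ≠ 0 := by exact_mod_cast (by linarith : tau ^ 2 - 1 ≠ 0)
  have hx' : x = t + (1 - t) * y / (tau ^ 2 - 1) := by
    rw [htdef]; field_simp; ring
  simp only [Fin.sum_univ_four, hz, Complex.real_smul, Matrix.cons_val_zero, Matrix.cons_val_one,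
    Matrix.cons_val]
  rw [hx']
  push_cast
  field_simp
  ring

lemma zeta_ne_one : ζ ≠ 1 := by
  intro h
  have := lin_zeta 0
  rw [h, lin_unit, ← val_sineZ, ← val_sineZ] at this
  have ht := tau_gt
  simp [sineZ, Zt.val] at this
  nlinarith

lemma rotation_centreA (z : ℂ) : rotation centreA z = ζ⁻¹ * z + (-2 : ℝ) * ζ⁻¹ := by
  have h1 : 1 - ζ ≠ 0 := sub_ne_zero.2 zeta_ne_one.symm
  have h0 : ζ ≠ 0 := Complex.exp_ne_zero _
  rw [rotation, centreA]
  push_cast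
  field_simp
  ring

lemma rotation_centreB (z : ℂ) : rotation centreB z = ζ⁻¹ * z + (-1 : ℝ) * ζ⁻¹ := by
  have h1 : 1 - ζ ≠ 0 := sub_ne_zero.2 zeta_ne_one.symm
  have h0 : ζ ≠ 0 := Complex.exp_ne_zero _
  rw [rotation, centreB]
  push_cast
  field_simp
  ring

/-- The open trapezium. -/
def trapeziumPoly : Poly :=
  [(0, ⟨-1, 0, 1⟩), (3, ⟨0, 0, 0⟩), (7, ⟨0, 0, 0⟩), (11, ⟨-1, 0, 1⟩)]

/-- The open triangle. -/
def trianglePoly : Poly := [(0, ⟨-1, 0, 1⟩), (4, ⟨1, 0, -1⟩), (10, ⟨-1, 0, 1⟩)]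

lemma lin_three (z : ℂ) : lin 3 z = lin 4 z + lin 0 z / (tau ^ 2 - 1) := by
  have ht := tau_gt
  have h0 : tau ^ 2 - 1 ≠ 0 := by nlinarith
  rw [lin_eq 3, lin_eq 4]
  simp only [← val_sineZ]
  simp [sineZ, Zt.val]
  field_simp
  linear_combination (tau * lin 0 z) * tau_cubic

lemma mem_region_triangle {z : ℂ} : z ∈ region trianglePoly ↔
    lin 0 z < tau ^ 2 - 1 ∧ lin 4 z < -(tau ^ 2 - 1) ∧ -lin 3 z < tau ^ 2 - 1 := by
  simp only [region, trianglePoly, Zt.val, List.forall_mem_cons, lin_add_seven 3]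
  constructor
  · rintro ⟨h0, h4, h10, -⟩
    push_cast at h0 h4 h10
    exact ⟨by linarith, by linarith, by linarith⟩
  · rintro ⟨h0, h4, h10⟩
    push_cast
    exact ⟨by linarith, by linarith, by linarith, by simp⟩

lemma mem_region_trapezium {z : ℂ} : z ∈ region trapeziumPoly ↔
    lin 0 z < tau ^ 2 - 1 ∧ lin 3 z < 0 ∧ -lin 0 z < 0 ∧ -lin 4 z < tau ^ 2 - 1 := by
  simp only [region, trapeziumPoly, Zt.val, List.forall_mem_cons, lin_add_seven 4,
    lin_add_seven 0]
  constructor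
  · rintro ⟨h0, h3, h7, h11, -⟩
    push_cast at h0 h3 h7 h11
    exact ⟨by linarith, by linarith, by linarith, by linarith⟩
  · rintro ⟨h0, h3, h7, h11⟩
    push_cast
    exact ⟨by linarith, by linarith, by linarith, by linarith, by simp⟩

lemma region_subset_interior_triangle : region trianglePoly ⊆ interior triangle := by
  refine interior_maximal (fun z hz => ?_) (isOpen_region _)
  obtain ⟨h0, h4, h3⟩ := mem_region_triangle.1 hz
  have ht := tau_gt
  have hs : 0 < tau ^ 2 - 1 := by nlinarith
  rw [lin_three] at h3
  rw [eq_add_mul_zeta z]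
  refine mem_triangle ((div_le_one hs).2 h0.le) ((one_le_div hs).2 (by linarith)) ?_
  rw [mul_sub, mul_div_cancel₀ _ hs.ne']
  linarith

lemma region_subset_interior_trapezium : region trapeziumPoly ⊆ interior trapezium := by
  refine interior_maximal (fun z hz => ?_) (isOpen_region _)
  obtain ⟨h0, h3, h7, h4⟩ := mem_region_trapezium.1 hz
  have ht := tau_gt
  have hs : 0 < tau ^ 2 - 1 := by nlinarith
  rw [lin_three] at h3
  rw [eq_add_mul_zeta z]
  refine mem_trapezium (div_nonneg (by linarith) hs.le) ((div_le_one hs).2 h0.le)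
    ((div_le_one hs).2 h4.le) ?_
  rw [mul_div_cancel₀ _ hs.ne']
  linarith

/-- The line through 1 and 1 + ζ separates the pieces. This is needed because `lozengeMap` tests the
triangle first. -/
lemma lin_four_le_of_mem_triangle {z : ℂ} (hz : z ∈ triangle) : lin 4 z ≤ -(tau ^ 2 - 1) := by
  refine lin_le_of_mem_convexHull ?_ hz
  rintro v (rfl | rfl | rfl) <;>
    simp only [sub_eq_add_neg, lin_add, lin_neg, lin_unit, lin_zeta, lin_zeta_inv, ← val_sineZ] <;>
    simp [sineZ, Zt.val]

lemma realised_lozengeScheme (e : ℂ → ℂ) :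
    Realised (lozengeMap e) lozengeScheme.pieces id := by
  intro A hA
  refine ⟨1, one_pos, fun z hz => ?_⟩
  simp only [lozengeScheme, List.mem_cons, List.not_mem_nil, or_false] at hA
  rw [Function.iterate_one, id, id]
  rcases hA with rfl | rfl
  · have h1 : z ∉ interior triangle := fun h => by
      have h2 := lin_four_le_of_mem_triangle (interior_subset h)
      have h3 := (mem_region_trapezium.1 hz).2.2.2
      linarith
    rw [lozengeMap, if_neg h1, if_pos (region_subset_interior_trapezium hz), rotation_centreB]
    apply ext_lin <;>
      rw [lin_add, lin_real_mul, lin_zeta_inv, zeta_inv, lin_turn_mul, Sim.lin_act, val_linZ] <;>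
      simp [Zt.val, ← val_sineZ, sineZ, Sim.dir]
  · rw [lozengeMap, if_pos (region_subset_interior_triangle hz), rotation_centreA]
    apply ext_lin <;>
      rw [lin_add, lin_real_mul, lin_zeta_inv, zeta_inv, lin_turn_mul, Sim.lin_act, val_linZ] <;>
      simp [Zt.val, ← val_sineZ, sineZ, Sim.dir]
    ring

/-- A generic point lies on none of the four sides nor on the cut, so its side of the cut determines
its open piece. -/
lemma mem_region_of_mem_lozenge {z : ℂ} (hz : z ∈ lozenge) (hg : Generic z) :
    z ∈ region trapeziumPoly ∨ z ∈ region trianglePoly := by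
  rw [mem_region_trapezium, mem_region_triangle]
  have ht := tau_gt
  have ht' : 1 ≤ |tau| := by linarith [le_abs_self tau]
  -- The four hypotheses are the inequality at the four vertices of the lozenge.
  have hv : ∀ m b, 0 ≤ b → -sine m ≤ b → -sine m + sine (m + 4) ≤ b → sine (m + 4) ≤ b →
      lin m z ≤ b := fun m b h1 h2 h3 h4 => by
    refine lin_le_of_mem_convexHull ?_ hz
    rintro v (rfl | rfl | rfl | rfl) <;>
      simpa only [sub_eq_add_neg, lin_add, lin_neg, lin_map_zero, lin_unit, lin_zeta_inv, neg_neg]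
  have h0 : lin 0 z ≤ tau ^ 2 - 1 := by
    apply hv <;> simp [← val_sineZ, sineZ, Zt.val, ht']
  have h7 : lin 7 z ≤ 0 := by
    apply hv <;> simp [← val_sineZ, sineZ, Zt.val, ht']
  have h3 : lin 3 z ≤ 0 := by
    apply hv <;> simp [← val_sineZ, sineZ, Zt.val, ht']
  have h10 : lin 10 z ≤ tau ^ 2 - 1 := by
    apply hv <;> simp [← val_sineZ, sineZ, Zt.val, ht']
  rw [lin_add_seven 0] at h7
  rw [lin_add_seven 3] at h10
  have g0 : lin 0 z ≠ tau ^ 2 - 1 := by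
    have := hg 0 ⟨-1, 0, 1⟩
    simpa [Zt.val, add_comm, sub_eq_add_neg] using this
  have g0' : lin 0 z ≠ 0 := by simpa [Zt.val] using hg 0 ⟨0, 0, 0⟩
  have g3 : lin 3 z ≠ 0 := by simpa [Zt.val] using hg 3 ⟨0, 0, 0⟩
  have g3' : lin 3 z ≠ -(tau ^ 2 - 1) := by
    have := hg 3 ⟨1, 0, -1⟩
    simpa [Zt.val, add_comm, sub_eq_add_neg] using this
  have g4 : lin 4 z ≠ -(tau ^ 2 - 1) := by
    have := hg 4 ⟨1, 0, -1⟩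
    simpa [Zt.val, add_comm, sub_eq_add_neg] using this
  have k0 := lt_of_le_of_ne h0 g0
  have k3 := lt_of_le_of_ne h3 g3
  have k7 : -lin 0 z < 0 := lt_of_le_of_ne h7 fun h => g0' (by linarith)
  have k10 : -lin 3 z < tau ^ 2 - 1 := lt_of_le_of_ne h10 fun h => g3' (by linarith)
  rcases lt_or_gt_of_ne g4 with h | h
  · exact Or.inr ⟨k0, h, k10⟩
  · exact Or.inl ⟨k0, k3, k7, by linarith⟩

end SevenFold

theorem mainTheorem6 (e : ℂ → ℂ) :
    ∀ᵐ z ∂(volume.restrict SevenFold.lozenge),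
      z ∈ Function.periodicPts (SevenFold.lozengeMap e) := by
  open SevenFold in
  have hm : MeasurableSet lozenge :=
    ((Set.toFinite _).isCompact_convexHull ℝ).isClosed.measurableSet
  have h : ∀ A ∈ lozengeScheme.pieces,
      ∀ᵐ z, ¬(z ∈ bad (lozengeMap e) id A.edges) := fun A hA => by
    rw [ae_iff]
    simpa using volume_bad_eq_zero (List.all_eq_true.1 checkScheme_schemes) (by simp [schemes])
      (realised_lozengeScheme e) hA
  rw [ae_restrict_iff' hm]
  filter_upwards [ae_generic, h _ (List.mem_cons_self), h _ (List.mem_cons_of_mem _ (List.mem_cons_self))]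
    with z hg h1 h2 hz
  by_contra hp
  rcases mem_region_of_mem_lozenge hz hg with hz | hz
  · exact h1 ⟨hz, hp⟩
  · exact h2 ⟨hz, hp⟩
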